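/- Let $\alpha_B\ge\alpha_E>0$, $\lambda_B,\lambda_E>0$, $\Delta>0$, $\mathcal A>0$ with $\lambda_B/\alpha_B\le\lambda_E/\alpha_E$, and suppose that at least one of the inequalities $\alpha_B\ge\alpha_E$, $\lambda_B/\alpha_B\le\lambda_E/\alpha_E$ is strict. In the degraded discrete-time Poisson wiretap channel, an input intensity $X\ge 0$ is sent in each time slot of $\Delta$ seconds; given $X=x$, the output $Y$ of the legitimate receiver and the output $Z$ of the eavesdropper are Poisson distributed with means $(\alpha_Bx+\lambda_B)\Delta$ and $(\alpha_Ex+\lambda_E)\Delta$, and successive slots are independent given the inputs. Logarithms are natural, and rates and mutual informations are measured in nats per second. For $\mathcal E>0$ let $C_S=C_S(\mathcal A,\mathcal E)$ be the secrecy capacity under the constraints $0\le X\le\mathcal A$ and $\mathbb E[X]\le\mathcal E$, that is, the supremum of the rates $R\ge 0$ for which there are codes, one for every block length $n$, with $\lceil e^{n\Delta R}\rceil$ equiprobable messages $W$, a (randomized) encoder whose inputs $X_1,\dots,X_n$ lie in $[0,\mathcal A]$ and satisfy $\frac1n\sum_{i}\mathbb E[X_i]\le\mathcal E$, and a decoder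 $g_n$, such that $\Pr[g_n(Y^n)\ne W]\to 0$ and $\frac1n I(W;Z^n)\to 0$ as $n\to\infty$. For a probability distribution $F$ on $[0,\mathcal A]$ put $f_0(F)=\frac1\Delta\left[I(X;Y)-I(X;Z)\right]$, where $X\sim F$ and both mutual informations are in nats per slot. Then, with $\mathcal A$ held fixed, $$\lim_{\mathcal E\downarrow 0}\frac{C_S}{\mathcal E}=L:=\left(\alpha_B+\frac{\lambda_B}{\mathcal A}\right)\log\left(1+\frac{\alpha_B\mathcal A}{\lambda_B}\right)-\left(\alpha_E+\frac{\lambda_E}{\mathcal A}\right)\log\left(1+\frac{\alpha_E\mathcal A}{\lambda_E}\right)+(\alpha_E-\alpha_B),$$ and $L>0$. The same limit holds with $C_S$ replaced by its single-letter expression $\sup_F f_0(F)$, the supremum being over all distributions $F$ on $[0,\mathcal A]$ with mean at most $\mathcal E$. (For every $\mathcal E>0$ both suprema are finite and over nonempty sets, and all the mutual informations $I(X;Y)$, $I(X;Z)$ occurring are finite.) The limit is achieved asymptotically by the binary input distribution $F_{\mathcal E}$ on $\{0,\mathcal A\}$ with $P(\mathcal A)=\mathcal E/\mathcal A$ and $P(0)=1-\mathcal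 E/\mathcal A$: it satisfies the constraints for $0<\mathcal E\le\mathcal A$, and $f_0(F_{\mathcal E})/\mathcal E\to L$ and $f_0(F_{\mathcal E})/C_S\to 1$ as $\mathcal E\downarrow 0$. -/

import Mathlib

open MeasureTheory ProbabilityTheory Filter Topology
open scoped ENNReal NNReal

namespace PoissonWiretap

/-- A map into the measures on a countable discrete space is measurable as soon as the mass of
every point is a measurable function. -/
theorem measurable_of_singleton {α β : Type*} [MeasurableSpace α] [MeasurableSpace β]
    [Countable β] [MeasurableSingletonClass β] {f : α → Measure β}
    (h : ∀ b, Measurable fun a => f a {b}) : Measurable f := by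
  refine Measure.measurable_of_measurable_coe _ fun s _ => ?_
  have hs : (fun a => f a s) = fun a => ∑' b : s, f a {(b : β)} := by
    funext a
    have hc := measure_biUnion (μ := f a) (s := s) (f := fun b => {b}) (Set.to_countable s)
      (fun x _ y _ hxy => by simpa [Function.onFun] using hxy)
      (fun b _ => measurableSet_singleton b)
    simpa using hc
  rw [hs]
  exact Measurable.tsum fun b => h b

/-- One use of the discrete-time Poisson channel with channel gain `a`, dark current `l` and pulse
duration `Δ` (seconds): given the intensity `x`, the output (the photon count) is Poisson
distributed with mean `(a * x + l) * Δ`. Only inputs `x ≥ 0` are ever used. -/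
noncomputable def poissonChannel (a l Δ : ℝ) : Kernel ℝ ℕ where
  toFun x := poissonMeasure ((a * x + l) * Δ).toNNReal
  measurable' := by
    refine measurable_of_singleton fun k => ?_
    simp only [poissonMeasure_singleton]
    fun_prop

instance (a l Δ : ℝ) : IsMarkovKernel (poissonChannel a l Δ) :=
  ⟨fun x => inferInstanceAs (IsProbabilityMeasure (poissonMeasure ((a * x + l) * Δ).toNNReal))⟩

/-- `n` memoryless uses of a channel with outputs in `ℕ`. -/
noncomputable def memoryless (κ : Kernel ℝ ℕ) [IsMarkovKernel κ] (n : ℕ) :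
    Kernel (Fin n → ℝ) (Fin n → ℕ) where
  toFun x := Measure.pi fun i => κ (x i)
  measurable' := by
    refine measurable_of_singleton fun y => ?_
    simp only [Measure.pi_singleton]
    exact Finset.measurable_prod _ fun i _ =>
      (κ.measurable_coe (measurableSet_singleton (y i))).comp (measurable_pi_apply i)

instance (κ : Kernel ℝ ℕ) [IsMarkovKernel κ] (n : ℕ) : IsMarkovKernel (memoryless κ n) :=
  ⟨fun x => inferInstanceAs (IsProbabilityMeasure (Measure.pi fun i => κ (x i)))⟩

/-- The mutual information (in nats) between the input, of law `μ`, and the output of the channel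
`κ`: the divergence of the joint law from the product of its marginals. -/
noncomputable def mutualInfo {α β : Type*} [MeasurableSpace α] [MeasurableSpace β]
    (μ : Measure α) (κ : Kernel α β) : ℝ≥0∞ :=
  InformationTheory.klDiv (μ ⊗ₘ κ) (μ.prod (κ ∘ₘ μ))

/-- A wiretap code with block length `n` and `M` messages, peak intensity `A` and average
intensity `E`. The encoder may use local randomness: message `m` is sent as a random vector of
intensities of law `enc m`. The message is uniformly distributed. -/
structure WiretapCode (A E : ℝ) (n M : ℕ) where
  /-- the stochastic encoder -/
  enc : Kernel (Fin M) (Fin n → ℝ)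
  markov : IsMarkovKernel enc
  /-- the decoder of the legitimate receiver -/
  dec : (Fin n → ℕ) → Fin M
  /-- the nonnegativity and peak-intensity constraint `0 ≤ X ≤ A` -/
  peak : ∀ m, ∀ᵐ x ∂(enc m), ∀ i, x i ∈ Set.Icc 0 A
  /-- the average-intensity constraint `𝔼[X] ≤ E`, the expectation being over the slots of the
  block, the message and the randomness of the encoder -/
  average : (∑ i, ∫ x, x i ∂(enc ∘ₘ uniformOn (Set.univ : Set (Fin M)))) / n ≤ E

/-- The probability `Pr[g(Yⁿ) ≠ W]` when the legitimate receiver observes the output of `κ`. -/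
noncomputable def WiretapCode.errorProb {A E : ℝ} {n M : ℕ} (c : WiretapCode A E n M)
    (κ : Kernel ℝ ℕ) [IsMarkovKernel κ] : ℝ≥0∞ :=
  (uniformOn (Set.univ : Set (Fin M)) ⊗ₘ (memoryless κ n ∘ₖ c.enc)) {p | c.dec p.2 ≠ p.1}

/-- The information `I(W; Zⁿ)` leaked about the message through the channel `κ`. -/
noncomputable def WiretapCode.leakage {A E : ℝ} {n M : ℕ} (c : WiretapCode A E n M)
    (κ : Kernel ℝ ℕ) [IsMarkovKernel κ] : ℝ≥0∞ :=
  mutualInfo (uniformOn (Set.univ : Set (Fin M))) (memoryless κ n ∘ₖ c.enc)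

/-- The perfectly secure rates, in nats per second, for the main channel `κB` and the
eavesdropper's channel `κE`, one use of which takes `Δ` seconds: there are codes with
`⌈exp (n Δ R)⌉` messages whose error probability and normalized leakage tend to zero. -/
def secureRates (κB κE : Kernel ℝ ℕ) [IsMarkovKernel κB] [IsMarkovKernel κE] (Δ A E : ℝ) :
    Set ℝ :=
  {R | 0 ≤ R ∧ ∃ c : ∀ n : ℕ, WiretapCode A E n ⌈Real.exp (n * Δ * R)⌉₊,
    Tendsto (fun n => (c n).errorProb κB) atTop (𝓝 0) ∧
    Tendsto (fun n : ℕ => (c n).leakage κE / n) atTop (𝓝 0)}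

/-- The secrecy capacity (nats per second): the supremum of the perfectly secure rates. -/
noncomputable def secrecyCapacity (κB κE : Kernel ℝ ℕ) [IsMarkovKernel κB] [IsMarkovKernel κE]
    (Δ A E : ℝ) : ℝ :=
  sSup (secureRates κB κE Δ A E)

/-- The input distributions on `[0, A]` with mean at most `E`. -/
def feasible (A E : ℝ) : Set (Measure ℝ) :=
  {μ | IsProbabilityMeasure μ ∧ (∀ᵐ x ∂μ, x ∈ Set.Icc 0 A) ∧ ∫ x, x ∂μ ≤ E}

/-- The mutual information difference `I(X;Y) - I(X;Z)` in nats per second, for an input of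
law `μ`. -/
noncomputable def infoDiff (κB κE : Kernel ℝ ℕ) (Δ : ℝ) (μ : Measure ℝ) : ℝ :=
  ((mutualInfo μ κB).toReal - (mutualInfo μ κE).toReal) / Δ

/-- The single-letter expression of the secrecy capacity: the supremum of `I(X;Y) - I(X;Z)` over
the feasible input distributions. -/
noncomputable def singleLetter (κB κE : Kernel ℝ ℕ) (Δ A E : ℝ) : ℝ :=
  sSup (infoDiff κB κE Δ '' feasible A E)

/-- The binary input distribution on `{0, A}` with `P(A) = E / A`, `P(0) = 1 - E / A`. -/
noncomputable def binaryInput (A E : ℝ) : Measure ℝ :=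
  ENNReal.ofReal (1 - E / A) • Measure.dirac 0 + ENNReal.ofReal (E / A) • Measure.dirac A

end PoissonWiretap

/-!
Everything is measured by the divergence of a channel output from the output `κ 0` of the zero
input. The identity `I(X;Y) = E[D(κ X ‖ κ 0)] - D(P_Y ‖ κ 0)`, applied to both receivers and
combined with the data processing inequality for the degrading channel from `Y` to `Z`, bounds
`I(X;Y) - I(X;Z)` by the mean of the gap `D(κB X ‖ κB 0) - D(κE X ‖ κE 0)`. For Poisson channels
this gap is convex in the intensity and vanishes at `0`, so on `[0, A]` it lies below its chord,
whose slope is `Δ L`; for block codes the same argument gives the converse. Conversely, for the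
binary input `D(P_Y ‖ κ 0)` is `O(E ^ 2)` by the chi-square bound on the divergence, and what
remains is linear in `E` with the slope of the chord. A random wiretap code turns this single-letter
rate into an operational one: the main receiver decodes by joint typicality, and the eavesdropper,
once told the message, could decode the random index, which therefore uses up his information.
-/

namespace PoissonWiretap

open InformationTheory

section Divergence

variable {α β : Type*} [MeasurableSpace α] [MeasurableSpace β]

theorem absolutelyContinuous_of_forall_singleton_ne_zero {ν : Measure β} (h : ∀ b, ν {b} ≠ 0)
    (μ : Measure β) : μ ≪ ν := by
  intro s hs
  have hs_empty : s = ∅ := Set.eq_empty_of_forall_notMem fun b hb =>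
    h b (measure_mono_null (Set.singleton_subset_iff.2 hb) hs)
  rw [hs_empty, measure_empty]

theorem klDiv_map_measurableEquiv (e : α ≃ᵐ β) (μ ν : Measure α) [IsFiniteMeasure μ]
    [IsFiniteMeasure ν] : klDiv (μ.map e) (ν.map e) = klDiv μ ν := by
  refine le_antisymm (klDiv_map_le _ _ e.measurable) ?_
  simpa using klDiv_map_le (μ.map e) (ν.map e) e.symm.measurable

theorem klDiv_map_swap (μ ν : Measure (α × β)) [IsFiniteMeasure μ] [IsFiniteMeasure ν] :
    klDiv (μ.map Prod.swap) (ν.map Prod.swap) = klDiv μ ν :=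
  klDiv_map_measurableEquiv MeasurableEquiv.prodComm μ ν

theorem klDiv_prod (μ ν : Measure α) (μ' ν' : Measure β) [IsProbabilityMeasure μ]
    [IsProbabilityMeasure ν] [IsProbabilityMeasure μ'] [IsProbabilityMeasure ν'] :
    klDiv (μ.prod μ') (ν.prod ν') = klDiv μ ν + klDiv μ' ν' := by
  rw [← Measure.compProd_const, ← Measure.compProd_const, klDiv_compProd_eq_add,
    Measure.compProd_const, Measure.compProd_const, ← klDiv_map_swap, Measure.prod_swap,
    Measure.prod_swap, ← Measure.compProd_const, ← Measure.compProd_const, klDiv_compProd_left]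

theorem klDiv_pi {n : ℕ} {β : Fin n → Type*} [∀ i, MeasurableSpace (β i)]
    (μ ν : ∀ i, Measure (β i)) [∀ i, IsProbabilityMeasure (μ i)]
    [∀ i, IsProbabilityMeasure (ν i)] :
    klDiv (Measure.pi μ) (Measure.pi ν) = ∑ i, klDiv (μ i) (ν i) := by
  induction n with
  | zero => rw [Measure.pi_of_empty, Measure.pi_of_empty, klDiv_self, Finset.univ_eq_empty,
      Finset.sum_empty]
  | succ n ih =>
    rw [← klDiv_map_measurableEquiv (MeasurableEquiv.piFinSuccAbove β 0),
      (measurePreserving_piFinSuccAbove μ 0).map_eq, (measurePreserving_piFinSuccAbove ν 0).map_eq,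
      klDiv_prod, ih, Fin.sum_univ_succ]
    rfl

theorem klDiv_withDensity_ofReal {ν : Measure α} [IsFiniteMeasure ν] {u : α → ℝ}
    (hu : Measurable u) (hu0 : ∀ x, 0 ≤ u x) (hui : Integrable u ν) :
    klDiv (ν.withDensity fun x => ENNReal.ofReal (u x)) ν
      = ∫⁻ x, ENNReal.ofReal (klFun (u x)) ∂ν := by
  have := isFiniteMeasure_withDensity_ofReal hui.2
  rw [klDiv_eq_lintegral_klFun_of_ac (withDensity_absolutelyContinuous _ _)]
  refine lintegral_congr_ae ?_
  filter_upwards [Measure.rnDeriv_withDensity ν hu.ennreal_ofReal] with x hx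
  rw [hx, ENNReal.toReal_ofReal (hu0 x)]

theorem mul_le_klFun_add_exp_sub_one (c : ℝ) {t : ℝ} (ht : 0 ≤ t) :
    c * t ≤ klFun t + (Real.exp c - 1) := by
  rcases ht.eq_or_lt with rfl | ht
  · simpa [klFun_zero] using (Real.exp_pos c).le
  · have h := Real.add_one_le_exp (c - Real.log t)
    rw [Real.exp_sub, Real.exp_log ht, le_div_iff₀ ht] at h
    rw [klFun_apply]
    linarith

/- Only the term `c * t` of the Donsker–Varadhan functional `c * 1_s` is kept: the pointwise Young
inequality for `klFun` is integrated over `s`. -/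
theorem mul_measure_le_klDiv_add (μ ν : Measure α) [IsFiniteMeasure μ] [IsFiniteMeasure ν]
    (s : Set α) {c : ℝ} (hc : 0 ≤ c) :
    ENNReal.ofReal c * μ s ≤ klDiv μ ν + ENNReal.ofReal (Real.exp c - 1) * ν s := by
  by_cases hac : μ ≪ ν
  swap
  · simp [klDiv_of_not_ac hac]
  have hexp : 0 ≤ Real.exp c - 1 := sub_nonneg.2 (Real.one_le_exp hc)
  calc ENNReal.ofReal c * μ s
      = ∫⁻ x in s, ENNReal.ofReal c * μ.rnDeriv ν x ∂ν := by
        rw [lintegral_const_mul _ (Measure.measurable_rnDeriv _ _),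
          Measure.setLIntegral_rnDeriv hac]
    _ ≤ ∫⁻ x in s, (ENNReal.ofReal (klFun (μ.rnDeriv ν x).toReal)
          + ENNReal.ofReal (Real.exp c - 1)) ∂ν := by
        refine lintegral_mono_ae (ae_restrict_of_ae ?_)
        filter_upwards [μ.rnDeriv_lt_top ν] with x hx
        nth_rw 1 [← ENNReal.ofReal_toReal hx.ne]
        rw [← ENNReal.ofReal_mul hc,
          ← ENNReal.ofReal_add (klFun_nonneg ENNReal.toReal_nonneg) hexp]
        exact ENNReal.ofReal_le_ofReal
          (mul_le_klFun_add_exp_sub_one c ENNReal.toReal_nonneg)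
    _ = ∫⁻ x in s, ENNReal.ofReal (klFun (μ.rnDeriv ν x).toReal) ∂ν
          + ENNReal.ofReal (Real.exp c - 1) * ν s := by
        rw [lintegral_add_right _ measurable_const, lintegral_const, Measure.restrict_apply_univ]
    _ ≤ _ := by
        rw [klDiv_eq_lintegral_klFun_of_ac hac]
        gcongr
        exact Measure.restrict_le_self

end Divergence

section KernelDivergence

variable {α β : Type*} [MeasurableSpace α] [MeasurableSpace β]
  [MeasurableSpace.CountableOrCountablyGenerated α β]
  {κ η : Kernel α β} [IsFiniteKernel κ] [IsFiniteKernel η]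

theorem klDiv_apply_eq_lintegral_klFun_rnDeriv {x : α} (h : κ x ≪ η x) :
    klDiv (κ x) (η x) = ∫⁻ y, ENNReal.ofReal (klFun (κ.rnDeriv η x y).toReal) ∂η x := by
  rw [klDiv_eq_lintegral_klFun_of_ac h]
  refine lintegral_congr_ae ?_
  filter_upwards [Kernel.rnDeriv_eq_rnDeriv_measure (κ := κ) (η := η) (a := x)] with y hy
  rw [hy]

theorem measurable_klDiv_kernel (h : ∀ x, κ x ≪ η x) : Measurable fun x => klDiv (κ x) (η x) := by
  simp only [klDiv_apply_eq_lintegral_klFun_rnDeriv (h _)]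
  refine Measurable.lintegral_kernel_prod_right ?_
  exact (measurable_klFun.comp (Kernel.measurable_rnDeriv κ η).ennreal_toReal).ennreal_ofReal

theorem klDiv_compProd_eq_lintegral (μ : Measure α) [IsFiniteMeasure μ] (h : ∀ x, κ x ≪ η x) :
    klDiv (μ ⊗ₘ κ) (μ ⊗ₘ η) = ∫⁻ x, klDiv (κ x) (η x) ∂μ := by
  have hmeas := Kernel.measurable_rnDeriv κ η
  have hκ : η.withDensity (κ.rnDeriv η) = κ := by
    ext x : 1
    exact Kernel.withDensity_rnDeriv_eq (h x)
  have : IsFiniteKernel (η.withDensity (κ.rnDeriv η)) := by rwa [hκ]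
  have hdensity : μ ⊗ₘ κ = (μ ⊗ₘ η).withDensity fun p => κ.rnDeriv η p.1 p.2 := by
    rw [← Measure.compProd_withDensity hmeas, hκ]
  have hderiv : (μ ⊗ₘ κ).rnDeriv (μ ⊗ₘ η) =ᵐ[μ ⊗ₘ η] fun p => κ.rnDeriv η p.1 p.2 := by
    rw [hdensity]
    exact Measure.rnDeriv_withDensity _ hmeas
  have hkl : Measurable fun p : α × β => ENNReal.ofReal (klFun (κ.rnDeriv η p.1 p.2).toReal) :=
    (measurable_klFun.comp hmeas.ennreal_toReal).ennreal_ofReal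
  have hac : μ ⊗ₘ κ ≪ μ ⊗ₘ η := hdensity ▸ withDensity_absolutelyContinuous _ _
  calc klDiv (μ ⊗ₘ κ) (μ ⊗ₘ η)
      = ∫⁻ p, ENNReal.ofReal (klFun (κ.rnDeriv η p.1 p.2).toReal) ∂(μ ⊗ₘ η) := by
        rw [klDiv_eq_lintegral_klFun_of_ac hac]
        exact lintegral_congr_ae (hderiv.mono fun p hp => by simp only [hp])
    _ = ∫⁻ x, klDiv (κ x) (η x) ∂μ := by
        rw [Measure.lintegral_compProd hkl]
        exact lintegral_congr fun x => (klDiv_apply_eq_lintegral_klFun_rnDeriv (h x)).symm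

end KernelDivergence

section MutualInformation

variable {W α β γ : Type*} [MeasurableSpace W] [MeasurableSpace α] [MeasurableSpace β]
  [MeasurableSpace γ]

theorem comp_absolutelyContinuous {μ : Measure α} {κ : Kernel α β} {ν : Measure β}
    (h : ∀ᵐ x ∂μ, κ x ≪ ν) : κ ∘ₘ μ ≪ ν := by
  refine Measure.AbsolutelyContinuous.mk fun s hs hνs => ?_
  rw [Measure.bind_apply hs κ.aemeasurable, lintegral_eq_zero_iff (κ.measurable_coe hs)]
  exact h.mono fun x hx => hx hνs

theorem klDiv_compProd_prod [StandardBorelSpace α] [Nonempty α] (μ : Measure α)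
    [IsProbabilityMeasure μ] (κ : Kernel α β) [IsMarkovKernel κ] (ν : Measure β)
    [IsProbabilityMeasure ν] :
    klDiv (μ ⊗ₘ κ) (μ.prod ν) = mutualInfo μ κ + klDiv (κ ∘ₘ μ) ν := by
  have hposterior : (μ ⊗ₘ κ).map Prod.swap = (κ ∘ₘ μ) ⊗ₘ κ†μ := compProd_posterior_eq_map_swap.symm
  rw [mutualInfo, ← klDiv_map_swap (μ ⊗ₘ κ), ← klDiv_map_swap (μ ⊗ₘ κ), hposterior,
    Measure.prod_swap, Measure.prod_swap, ← Measure.compProd_const, ← Measure.compProd_const,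
    klDiv_compProd_eq_add, add_comm]

theorem lintegral_klDiv_eq_mutualInfo_add [StandardBorelSpace α] [Nonempty α]
    [MeasurableSpace.CountableOrCountablyGenerated α β] (μ : Measure α) [IsProbabilityMeasure μ]
    (κ : Kernel α β) [IsMarkovKernel κ] (ν : Measure β) [IsProbabilityMeasure ν]
    (hac : ∀ x, κ x ≪ ν) :
    ∫⁻ x, klDiv (κ x) ν ∂μ = mutualInfo μ κ + klDiv (κ ∘ₘ μ) ν := by
  rw [← klDiv_compProd_prod, ← Measure.compProd_const,
    klDiv_compProd_eq_lintegral (η := Kernel.const α ν) μ hac]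
  simp only [Kernel.const_apply]

theorem lintegral_klDiv_comp_eq [StandardBorelSpace W] [Nonempty W] [StandardBorelSpace α]
    [Nonempty α] [MeasurableSpace.CountablyGenerated β] (U : Measure W) [IsProbabilityMeasure U]
    (enc : Kernel W α) [IsMarkovKernel enc] (κ : Kernel α β) [IsMarkovKernel κ] (ν : Measure β)
    [IsProbabilityMeasure ν] (hac : ∀ x, κ x ≪ ν) :
    ∫⁻ x, klDiv (κ x) ν ∂(enc ∘ₘ U) = ∫⁻ w, mutualInfo (enc w) κ ∂U
      + (mutualInfo U (κ ∘ₖ enc) + klDiv (κ ∘ₘ (enc ∘ₘ U)) ν) := by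
  have hcomp (w : W) : (κ ∘ₖ enc) w ≪ ν := by
    rw [Kernel.comp_apply]
    exact comp_absolutelyContinuous (ae_of_all _ hac)
  have hκ : Measurable fun x => klDiv (κ x) ν :=
    measurable_klDiv_kernel (η := Kernel.const α ν) hac
  have hκenc : Measurable fun w => klDiv ((κ ∘ₖ enc) w) ν :=
    measurable_klDiv_kernel (η := Kernel.const W ν) hcomp
  rw [Measure.lintegral_bind enc.aemeasurable hκ.aemeasurable, Measure.comp_assoc,
    ← lintegral_klDiv_eq_mutualInfo_add U (κ ∘ₖ enc) ν hcomp, ← lintegral_add_right _ hκenc]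
  refine lintegral_congr fun w => ?_
  rw [lintegral_klDiv_eq_mutualInfo_add (enc w) κ ν hac, Kernel.comp_apply]

theorem mutualInfo_comp_le (μ : Measure α) [IsProbabilityMeasure μ]
    (κ : Kernel α β) [IsMarkovKernel κ] (η : Kernel β γ) [IsMarkovKernel η] :
    mutualInfo μ (η ∘ₖ κ) ≤ mutualInfo μ κ := by
  have hjoint : (Kernel.id ∥ₖ η) ∘ₘ (μ ⊗ₘ κ) = μ ⊗ₘ (η ∘ₖ κ) := by
    rw [Measure.compProd_eq_comp_prod, Measure.compProd_eq_comp_prod, Measure.comp_assoc,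
      Kernel.parallelComp_comp_prod, Kernel.id_comp]
  have hprod : (Kernel.id ∥ₖ η) ∘ₘ (μ.prod (κ ∘ₘ μ)) = μ.prod ((η ∘ₖ κ) ∘ₘ μ) := by
    rw [← Measure.compProd_const, ← Measure.compProd_const, Measure.compProd_eq_comp_prod,
      Measure.compProd_eq_comp_prod, Measure.comp_assoc,
      Kernel.parallelComp_comp_prod, Kernel.id_comp, Kernel.comp_const, Measure.comp_assoc]
  rw [mutualInfo, mutualInfo, ← hjoint, ← hprod]
  exact klDiv_comp_right_le _ _ _

theorem mutualInfo_congr {μ : Measure α} {κ η : Kernel α β} [IsSFiniteKernel κ]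
    [IsSFiniteKernel η] (h : κ =ᵐ[μ] η) :
    mutualInfo μ κ = mutualInfo μ η := by
  rw [mutualInfo, mutualInfo, Measure.compProd_congr h, Measure.bind_congr_right h]

theorem mutualInfo_le_of_degraded (μ : Measure α) [IsProbabilityMeasure μ] (κ : Kernel α β)
    [IsMarkovKernel κ] (η : Kernel α γ) [IsSFiniteKernel η] (T : Kernel β γ)
    [IsMarkovKernel T] (hT : ∀ᵐ x ∂μ, T ∘ₘ κ x = η x) : mutualInfo μ η ≤ mutualInfo μ κ := by
  have hη : T ∘ₖ κ =ᵐ[μ] η := hT.mono fun x hx => by rw [Kernel.comp_apply, hx]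
  rw [← mutualInfo_congr hη]
  exact mutualInfo_comp_le μ κ T

/- Averaging over the randomness of the encoder, the compensation identity for the two channels
differs in two places: the information the codeword carries beyond the message, and the divergence
of the output law. Both are larger for the better channel. -/
theorem mutualInfo_add_lintegral_klDiv_le_of_degraded [StandardBorelSpace W] [Nonempty W]
    [StandardBorelSpace α] [Nonempty α] [MeasurableSpace.CountablyGenerated β]
    [MeasurableSpace.CountablyGenerated γ] (U : Measure W) [IsProbabilityMeasure U]
    (enc : Kernel W α) [IsMarkovKernel enc] (κ : Kernel α β) [IsMarkovKernel κ] (η : Kernel α γ)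
    [IsMarkovKernel η] (T : Kernel β γ) [IsMarkovKernel T]
    (hT : ∀ᵐ x ∂(enc ∘ₘ U), T ∘ₘ κ x = η x) (ν : Measure β) [IsProbabilityMeasure ν]
    (hκ : ∀ x, κ x ≪ ν) (hη : ∀ x, η x ≪ T ∘ₘ ν) :
    mutualInfo U (κ ∘ₖ enc) + ∫⁻ x, klDiv (η x) (T ∘ₘ ν) ∂(enc ∘ₘ U)
      ≤ mutualInfo U (η ∘ₖ enc) + ∫⁻ x, klDiv (κ x) ν ∂(enc ∘ₘ U) := by
  have hout : η ∘ₘ (enc ∘ₘ U) = T ∘ₘ (κ ∘ₘ (enc ∘ₘ U)) := by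
    rw [Measure.comp_assoc (κ := κ) (η := T)]
    exact Measure.bind_congr_right (hT.mono fun x hx => by rw [Kernel.comp_apply, hx])
  have hinfo : ∫⁻ w, mutualInfo (enc w) η ∂U ≤ ∫⁻ w, mutualInfo (enc w) κ ∂U :=
    lintegral_mono_ae ((Measure.ae_ae_of_ae_comp hT).mono fun w hw =>
      mutualInfo_le_of_degraded (enc w) κ η T hw)
  have hdiv := klDiv_comp_right_le (κ ∘ₘ (enc ∘ₘ U)) ν T
  rw [lintegral_klDiv_comp_eq U enc κ ν hκ, lintegral_klDiv_comp_eq U enc η _ hη, hout]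
  calc _ = mutualInfo U (η ∘ₖ enc) + (∫⁻ w, mutualInfo (enc w) η ∂U + (mutualInfo U (κ ∘ₖ enc)
        + klDiv (T ∘ₘ (κ ∘ₘ (enc ∘ₘ U))) (T ∘ₘ ν))) := by ring
    _ ≤ _ := by gcongr

theorem mutualInfo_le_add_of_degraded [StandardBorelSpace W] [Nonempty W]
    [StandardBorelSpace α] [Nonempty α] [MeasurableSpace.CountablyGenerated β]
    [MeasurableSpace.CountablyGenerated γ] (U : Measure W) [IsProbabilityMeasure U]
    (enc : Kernel W α) [IsMarkovKernel enc] (κ : Kernel α β) [IsMarkovKernel κ] (η : Kernel α γ)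
    [IsMarkovKernel η] (T : Kernel β γ) [IsMarkovKernel T]
    (hT : ∀ᵐ x ∂(enc ∘ₘ U), T ∘ₘ κ x = η x) (ν : Measure β) [IsProbabilityMeasure ν]
    (hκ : ∀ x, κ x ≪ ν) (hη : ∀ x, η x ≪ T ∘ₘ ν)
    (hfin : ∫⁻ x, klDiv (η x) (T ∘ₘ ν) ∂(enc ∘ₘ U) ≠ ∞) {c : ℝ≥0∞}
    (hgap : ∫⁻ x, klDiv (κ x) ν ∂(enc ∘ₘ U) ≤ ∫⁻ x, klDiv (η x) (T ∘ₘ ν) ∂(enc ∘ₘ U) + c) :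
    mutualInfo U (κ ∘ₖ enc) ≤ mutualInfo U (η ∘ₖ enc) + c := by
  refine (ENNReal.add_le_add_iff_right hfin).1 ?_
  calc _ ≤ _ := mutualInfo_add_lintegral_klDiv_le_of_degraded U enc κ η T hT ν hκ hη
    _ ≤ _ := add_le_add_right hgap _
    _ = _ := by ring

end MutualInformation

section Fano

variable {W β : Type*} [Fintype W] [MeasurableSpace W] [MeasurableSingletonClass W]
  [MeasurableSpace β]

theorem prod_uniformOn_univ_setOf_eq {dec : β → W} (hdec : Measurable dec) (ν : Measure β)
    [IsProbabilityMeasure ν] :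
    ((uniformOn (Set.univ : Set W)).prod ν) {p | dec p.2 = p.1} = (Fintype.card W : ℝ≥0∞)⁻¹ := by
  have hs : MeasurableSet {p : W × β | dec p.2 = p.1} :=
    measurableSet_eq_fun (hdec.comp measurable_snd) measurable_fst
  have hsection (y : β) : (fun w => (w, y)) ⁻¹' {p : W × β | dec p.2 = p.1} = {dec y} := by
    ext w
    simp [eq_comm]
  simp [Measure.prod_apply_symm hs, hsection, uniformOn_univ]

/- Fano's inequality: test the joint law against the product of its marginals on the event of
correct decoding, which has probability `1 / |W|` under the latter. -/
theorem log_card_mul_le_mutualInfo_add_one [Nonempty W] (κ : Kernel W β) [IsMarkovKernel κ]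
    {dec : β → W} (hdec : Measurable dec) :
    ENNReal.ofReal (Real.log (Fintype.card W))
        * (1 - (uniformOn (Set.univ : Set W) ⊗ₘ κ) {p | dec p.2 ≠ p.1})
      ≤ mutualInfo (uniformOn (Set.univ : Set W)) κ + 1 := by
  set U := uniformOn (Set.univ : Set W)
  have hcard : (1 : ℝ) ≤ Fintype.card W := by exact_mod_cast Fintype.card_pos
  have hs : MeasurableSet {p : W × β | dec p.2 = p.1} :=
    measurableSet_eq_fun (hdec.comp measurable_snd) measurable_fst
  have hcorrect : 1 - (U ⊗ₘ κ) {p | dec p.2 ≠ p.1} = (U ⊗ₘ κ) {p | dec p.2 = p.1} := by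
    have h := prob_compl_eq_one_sub (μ := U ⊗ₘ κ) hs.compl
    rwa [compl_compl, eq_comm] at h
  have hguess : ENNReal.ofReal (Real.exp (Real.log (Fintype.card W)) - 1)
      * (U.prod (κ ∘ₘ U)) {p | dec p.2 = p.1} ≤ 1 := by
    rw [prod_uniformOn_univ_setOf_eq hdec, Real.exp_log (by linarith), ← div_eq_mul_inv]
    refine ENNReal.div_le_of_le_mul ?_
    rw [one_mul, ← ENNReal.ofReal_natCast]
    exact ENNReal.ofReal_le_ofReal (sub_le_self _ zero_le_one)
  rw [hcorrect]
  exact (mul_measure_le_klDiv_add _ _ _ (Real.log_nonneg hcard)).trans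
    (add_le_add_right hguess _)

end Fano

section ProductKernel

theorem lintegral_prod_pi {ι : Type*} [Fintype ι] {β : ι → Type*} [∀ i, MeasurableSpace (β i)]
    (μ : ∀ i, Measure (β i)) [∀ i, IsProbabilityMeasure (μ i)] {f : ∀ i, β i → ℝ≥0∞}
    (hf : ∀ i, Measurable (f i)) :
    ∫⁻ y, ∏ i, f i (y i) ∂Measure.pi μ = ∏ i, ∫⁻ b, f i b ∂μ i := by
  rw [lintegral_prod_eq_prod_lintegral_of_indepFun Finset.univ
    (fun i (y : ∀ i, β i) => f i (y i)) (iIndepFun_pi fun i => (hf i).aemeasurable)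
    fun i => (hf i).comp (measurable_pi_apply i)]
  exact Finset.prod_congr rfl fun i _ => (measurePreserving_eval μ i).lintegral_comp (hf i)

/-- The product of `n` copies of a kernel between counts: the degrading kernel of a memoryless
channel. -/
noncomputable def productKernel (T : Kernel ℕ ℕ) (n : ℕ) : Kernel (Fin n → ℕ) (Fin n → ℕ) :=
  Kernel.ofFunOfCountable fun y => Measure.pi fun i => T (y i)

instance (T : Kernel ℕ ℕ) [IsMarkovKernel T] (n : ℕ) : IsMarkovKernel (productKernel T n) :=
  ⟨fun y => inferInstanceAs (IsProbabilityMeasure (Measure.pi fun i => T (y i)))⟩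

theorem productKernel_apply_singleton (T : Kernel ℕ ℕ) [IsMarkovKernel T] {n : ℕ}
    (y z : Fin n → ℕ) : productKernel T n y {z} = ∏ i, T (y i) {z i} :=
  Measure.pi_singleton _ _

theorem productKernel_comp_pi (T : Kernel ℕ ℕ) [IsMarkovKernel T] {n : ℕ}
    (μ : Fin n → Measure ℕ) [∀ i, IsProbabilityMeasure (μ i)] :
    productKernel T n ∘ₘ Measure.pi μ = Measure.pi fun i => T ∘ₘ μ i := by
  refine Measure.ext_of_singleton fun z => ?_
  rw [Measure.bind_apply (measurableSet_singleton z) (Kernel.aemeasurable _), Measure.pi_singleton]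
  simp only [productKernel_apply_singleton]
  rw [lintegral_prod_pi μ (f := fun i y => T y {z i}) fun i => .of_discrete]
  exact Finset.prod_congr rfl fun i _ =>
    (Measure.bind_apply (measurableSet_singleton _) (Kernel.aemeasurable _)).symm

theorem memoryless_apply (κ : Kernel ℝ ℕ) [IsMarkovKernel κ] {n : ℕ} (x : Fin n → ℝ) :
    memoryless κ n x = Measure.pi fun i => κ (x i) := rfl

theorem klDiv_memoryless (κ η : Kernel ℝ ℕ) [IsMarkovKernel κ] [IsMarkovKernel η] {n : ℕ}
    (x y : Fin n → ℝ) :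
    klDiv (memoryless κ n x) (memoryless η n y) = ∑ i, klDiv (κ (x i)) (η (y i)) :=
  klDiv_pi _ _

theorem productKernel_comp_memoryless {κ η T} [IsMarkovKernel κ] [IsMarkovKernel η]
    [IsMarkovKernel T] {n : ℕ} {x : Fin n → ℝ} (h : ∀ i, T ∘ₘ κ (x i) = η (x i)) :
    productKernel T n ∘ₘ memoryless κ n x = memoryless η n x := by
  rw [memoryless_apply, memoryless_apply, productKernel_comp_pi]
  simp only [h]

end ProductKernel

section Poisson

/-- Independent thinning of a count, every point being kept with probability `q`. It turns the
gain of the main channel into that of the eavesdropper. -/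
noncomputable def thinning (q : unitInterval) : Kernel ℕ ℕ :=
  Kernel.ofFunOfCountable fun n => binomial n q

instance (q : unitInterval) : IsMarkovKernel (thinning q) :=
  ⟨fun n => inferInstanceAs (IsProbabilityMeasure (binomial n q))⟩

/-- Superposition with an independent Poisson count of mean `c`. It supplies the excess dark
current of the eavesdropper. -/
noncomputable def poissonNoise (c : ℝ≥0) : Kernel ℕ ℕ :=
  Kernel.ofFunOfCountable fun n => (poissonMeasure c).map (n + ·)

instance (c : ℝ≥0) : IsMarkovKernel (poissonNoise c) :=
  ⟨fun n => Measure.isProbabilityMeasure_map (μ := poissonMeasure c) (f := (n + ·))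
    Measurable.of_discrete.aemeasurable⟩

theorem poissonNoise_comp_poissonMeasure (c r : ℝ≥0) :
    poissonNoise c ∘ₘ poissonMeasure r = poissonMeasure (r + c) := by
  rw [← poissonMeasure_conv_poissonMeasure]
  ext s hs
  rw [Measure.bind_apply hs (Kernel.aemeasurable _), Measure.conv,
    Measure.map_apply (by fun_prop) hs, Measure.prod_apply .of_discrete]
  exact lintegral_congr fun n => Measure.map_apply .of_discrete hs

/- A Poisson count with `n = k + m` points splits into independent Poisson counts of kept and
deleted points, of means `q * r` and `(1 - q) * r`. -/
theorem choose_mul_poisson_weight (q r : ℝ) (k m : ℕ) :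
    ((m + k).choose k) * q ^ k * (1 - q) ^ m
        * (Real.exp (-r) * r ^ (m + k) / (m + k).factorial)
      = Real.exp (-(q * r)) * (q * r) ^ k / k.factorial
        * (Real.exp (-((1 - q) * r)) * ((1 - q) * r) ^ m / m.factorial) := by
  have hexp : Real.exp (-r) = Real.exp (-(q * r)) * Real.exp (-((1 - q) * r)) := by
    rw [← Real.exp_add]
    ring_nf
  rw [add_comm m k, Nat.cast_add_choose, hexp, mul_pow, mul_pow, pow_add]
  field_simp

theorem hasSum_choose_mul_poisson_weight (q : unitInterval) (r : ℝ≥0) (k : ℕ) :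
    HasSum (fun n : ℕ => (n.choose k) * (q : ℝ) ^ k * (1 - q) ^ (n - k)
        * (Real.exp (-r) * r ^ n / n.factorial))
      (Real.exp (-(q * r)) * (q * r) ^ k / k.factorial) := by
  have hdeleted := hasSum_one_poissonMeasure (Real.toNNReal (1 - q) * r)
  rw [NNReal.coe_mul, Real.coe_toNNReal _ (sub_nonneg.2 q.2.2)] at hdeleted
  rw [← hasSum_nat_add_iff' k, Finset.sum_eq_zero fun i hi => by
    rw [Nat.choose_eq_zero_of_lt (Finset.mem_range.1 hi)]; simp, sub_zero]
  simp only [Nat.add_sub_cancel, choose_mul_poisson_weight]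
  simpa only [mul_one] using hdeleted.mul_left (Real.exp (-(q * r)) * (q * r) ^ k / k.factorial)

theorem thinning_comp_poissonMeasure (q : unitInterval) (r : ℝ≥0) :
    thinning q ∘ₘ poissonMeasure r = poissonMeasure (Real.toNNReal q * r) := by
  refine Measure.ext_of_singleton fun k => ?_
  have hq0 : (0 : ℝ) ≤ q := q.2.1
  have hq1 : (0 : ℝ) ≤ 1 - q := sub_nonneg.2 q.2.2
  have hterm (n : ℕ) : thinning q n {k} * poissonMeasure r {n} =
      ENNReal.ofReal ((n.choose k) * q ^ k * (1 - q) ^ (n - k)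
        * (Real.exp (-r) * r ^ n / n.factorial)) := by
    change binomial n q {k} * _ = _
    rw [binomial_singleton, poissonMeasure_singleton, ← ENNReal.ofReal_mul (by positivity)]
  have hsum := hasSum_choose_mul_poisson_weight q r k
  rw [Measure.bind_apply (measurableSet_singleton k) (Kernel.aemeasurable _), lintegral_countable']
  simp only [hterm]
  rw [← ENNReal.ofReal_tsum_of_nonneg (fun n => by positivity) hsum.summable, hsum.tsum_eq,
    poissonMeasure_singleton, NNReal.coe_mul, Real.coe_toNNReal _ hq0]

theorem integrable_pow_poissonMeasure (r : ℝ≥0) (ρ : ℝ) :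
    Integrable (fun n : ℕ => ρ ^ n) (poissonMeasure r) := by
  rw [integrable_poissonMeasure_iff]
  refine ((Real.summable_pow_div_factorial (r * |ρ|)).mul_left (Real.exp (-r))).congr fun n => ?_
  rw [norm_pow, Real.norm_eq_abs, mul_pow]
  ring

theorem hasSum_poisson_weight_mul_natCast (r : ℝ≥0) :
    HasSum (fun n : ℕ => Real.exp (-r) * r ^ n / n.factorial * (n : ℝ)) r := by
  have hshift (n : ℕ) : Real.exp (-r) * (r : ℝ) ^ (n + 1) / (n + 1).factorial * (n + 1 : ℕ)
      = r * (Real.exp (-r) * r ^ n / n.factorial) := by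
    rw [Nat.factorial_succ, Nat.cast_mul, pow_succ]
    field_simp
  rw [← hasSum_nat_add_iff' 1]
  simp only [hshift]
  simpa using (hasSum_one_poissonMeasure r).mul_left (r : ℝ)

theorem integrable_natCast_poissonMeasure (r : ℝ≥0) :
    Integrable (fun n : ℕ => (n : ℝ)) (poissonMeasure r) := by
  rw [integrable_poissonMeasure_iff]
  simpa using (hasSum_poisson_weight_mul_natCast r).summable

theorem integral_natCast_poissonMeasure (r : ℝ≥0) :
    ∫ n : ℕ, (n : ℝ) ∂poissonMeasure r = r := by
  rw [integral_poissonMeasure]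
  exact (hasSum_poisson_weight_mul_natCast r).tsum_eq

theorem poissonMeasure_eq_withDensity (r : ℝ≥0) {s : ℝ≥0} (hs : 0 < s) :
    poissonMeasure r = (poissonMeasure s).withDensity fun n =>
      ENNReal.ofReal (Real.exp (s - r) * ((r : ℝ) / s) ^ n) := by
  have : (0 : ℝ) < s := hs
  refine Measure.ext_of_singleton fun n => ?_
  rw [withDensity_apply _ (measurableSet_singleton n), lintegral_singleton,
    poissonMeasure_singleton, poissonMeasure_singleton, ← ENNReal.ofReal_mul (by positivity),
    sub_eq_add_neg, Real.exp_add, div_pow, Real.exp_neg (s : ℝ)]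
  congr 1
  field_simp

theorem poissonMeasure_absolutelyContinuous (r : ℝ≥0) {s : ℝ≥0} (hs : 0 < s) :
    poissonMeasure r ≪ poissonMeasure s := by
  rw [poissonMeasure_eq_withDensity r hs]
  exact withDensity_absolutelyContinuous _ _

theorem llr_poissonMeasure {r s : ℝ≥0} (hr : 0 < r) (hs : 0 < s) :
    llr (poissonMeasure r) (poissonMeasure s)
      =ᵐ[poissonMeasure r] fun n : ℕ => (s - r : ℝ) + n * Real.log (r / s) := by
  have : (0 : ℝ) < r := hr
  have : (0 : ℝ) < s := hs
  have hderiv := Measure.rnDeriv_withDensity (poissonMeasure s) (f := fun n : ℕ =>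
    ENNReal.ofReal (Real.exp (s - r) * ((r : ℝ) / s) ^ n)) .of_discrete
  rw [← poissonMeasure_eq_withDensity r hs] at hderiv
  filter_upwards [(poissonMeasure_absolutelyContinuous r hs).ae_le hderiv] with n hn
  rw [llr, hn, ENNReal.toReal_ofReal (by positivity), Real.log_mul (by positivity)
    (by positivity), Real.log_exp, Real.log_pow]

theorem klDiv_poissonMeasure {r s : ℝ≥0} (hr : 0 < r) (hs : 0 < s) :
    klDiv (poissonMeasure r) (poissonMeasure s)
      = ENNReal.ofReal (r * Real.log (r / s) + s - r) := by
  have hint := (integrable_natCast_poissonMeasure r).mul_const (Real.log (r / s))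
  have hllr : Integrable (llr (poissonMeasure r) (poissonMeasure s)) (poissonMeasure r) :=
    (integrable_congr (llr_poissonMeasure hr hs)).2 ((integrable_const _).add hint)
  rw [klDiv_of_ac_of_integrable (poissonMeasure_absolutelyContinuous r hs) hllr,
    integral_congr_ae (llr_poissonMeasure hr hs), integral_add (integrable_const _) hint,
    integral_mul_const, integral_natCast_poissonMeasure]
  simp only [integral_const, probReal_univ, smul_eq_mul]
  congr 1
  ring

theorem lintegral_poisson_chiSq_ne_top (r s : ℝ≥0) :
    ∫⁻ n : ℕ, ENNReal.ofReal ((Real.exp (s - r) * ((r : ℝ) / s) ^ n - 1) ^ 2)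
      ∂poissonMeasure s ≠ ∞ := by
  have hint : Integrable (fun n : ℕ => (Real.exp (s - r) * ((r : ℝ) / s) ^ n - 1) ^ 2)
      (poissonMeasure s) := by
    have hsq := (integrable_pow_poissonMeasure s (((r : ℝ) / s) ^ 2)).const_mul
      (Real.exp (s - r) ^ 2)
    have hlin := (integrable_pow_poissonMeasure s ((r : ℝ) / s)).const_mul (2 * Real.exp (s - r))
    refine ((hsq.sub hlin).add (integrable_const (1 : ℝ))).congr (ae_of_all _ fun n => ?_)
    simp only [Pi.add_apply, Pi.sub_apply]
    ring
  exact ((hasFiniteIntegral_iff_ofReal (ae_of_all _ fun n => sq_nonneg _)).1 hint.2).ne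

end Poisson

section Mixture

variable {α : Type*} [MeasurableSpace α]

theorem klFun_le_sq_sub_one {t : ℝ} (ht : 0 ≤ t) : klFun t ≤ (t - 1) ^ 2 := by
  rcases ht.eq_or_lt with rfl | ht
  · simp [klFun_zero]
  · rw [klFun_apply]
    nlinarith [mul_le_mul_of_nonneg_left (Real.log_le_sub_one_of_pos ht) ht.le]

theorem klDiv_mixture_le {ν : Measure α} [IsFiniteMeasure ν] {u : α → ℝ} (hu : Measurable u)
    (hu0 : ∀ x, 0 ≤ u x) (hui : Integrable u ν) {p : ℝ} (hp0 : 0 ≤ p) (hp1 : p ≤ 1) :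
    klDiv (ENNReal.ofReal (1 - p) • ν
        + ENNReal.ofReal p • ν.withDensity fun x => ENNReal.ofReal (u x)) ν
      ≤ ENNReal.ofReal (p ^ 2) * ∫⁻ x, ENNReal.ofReal ((u x - 1) ^ 2) ∂ν := by
  have hq0 : 0 ≤ 1 - p := sub_nonneg.2 hp1
  have hmix0 (x : α) : 0 ≤ 1 - p + p * u x := add_nonneg hq0 (mul_nonneg hp0 (hu0 x))
  have hmix : ENNReal.ofReal (1 - p) • ν
      + ENNReal.ofReal p • ν.withDensity (fun x => ENNReal.ofReal (u x))
      = ν.withDensity fun x => ENNReal.ofReal (1 - p + p * u x) := by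
    rw [← withDensity_const, ← withDensity_smul _ hu.ennreal_ofReal,
      ← withDensity_add_left measurable_const]
    congr with x
    simp only [Pi.add_apply, Pi.smul_apply, smul_eq_mul]
    rw [ENNReal.ofReal_add hq0 (mul_nonneg hp0 (hu0 x)), ENNReal.ofReal_mul hp0]
  rw [hmix, klDiv_withDensity_ofReal (by fun_prop) hmix0
    ((integrable_const _).add (hui.const_mul p)), ← lintegral_const_mul _ (by fun_prop)]
  refine lintegral_mono fun x => ?_
  rw [← ENNReal.ofReal_mul (sq_nonneg p)]
  refine ENNReal.ofReal_le_ofReal ((klFun_le_sq_sub_one (hmix0 x)).trans_eq ?_)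
  ring

end Mixture

section DivergenceRate

/-- The divergence, in nats per second, between the outputs of a Poisson channel of gain `a` and
dark current `l` for the intensities `x` and `0`. -/
noncomputable def divRate (a l x : ℝ) : ℝ := (a * x + l) * Real.log (1 + a * x / l) - a * x

theorem divRate_zero (a l : ℝ) : divRate a l 0 = 0 := by simp [divRate]

theorem divRate_nonneg {a l x : ℝ} (ha : 0 ≤ a) (hl : 0 < l) (hx : 0 ≤ x) :
    0 ≤ divRate a l x := by
  have hpos : 0 ≤ 1 + a * x / l := by positivity
  have heq : divRate a l x = l * klFun (1 + a * x / l) := by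
    rw [klFun_apply, divRate]
    field_simp
    ring
  rw [heq]
  exact mul_nonneg hl.le (klFun_nonneg hpos)

theorem hasDerivAt_one_add_mul_div (a l x : ℝ) :
    HasDerivAt (fun y : ℝ => 1 + a * y / l) (a / l) x := by
  simpa using (((hasDerivAt_id x).const_mul a).div_const l).const_add 1

theorem hasDerivAt_divRate {a l x : ℝ} (ha : 0 ≤ a) (hl : 0 < l) (hx : 0 ≤ x) :
    HasDerivAt (divRate a l) (a * Real.log (1 + a * x / l)) x := by
  have hpos : 0 < 1 + a * x / l := by positivity
  have hlin : HasDerivAt (fun y : ℝ => a * y) a x := by simpa using (hasDerivAt_id x).const_mul a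
  refine (((hlin.add_const l).mul ((hasDerivAt_one_add_mul_div a l x).log hpos.ne')).sub
    hlin).congr_deriv ?_
  have hne : l + a * x ≠ 0 := by positivity
  field_simp
  ring

theorem hasDerivAt_mul_log {a l x : ℝ} (ha : 0 ≤ a) (hl : 0 < l) (hx : 0 ≤ x) :
    HasDerivAt (fun y => a * Real.log (1 + a * y / l)) (a ^ 2 / (l + a * x)) x := by
  have hpos : 0 < 1 + a * x / l := by positivity
  refine (((hasDerivAt_one_add_mul_div a l x).log hpos.ne').const_mul a).congr_deriv ?_
  have hne : l + a * x ≠ 0 := by positivity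
  field_simp

end DivergenceRate

section Gap

variable {aB lB aE lE : ℝ}

theorem hasDerivAt_divRate_sub (haB : 0 ≤ aB) (haE : 0 ≤ aE) (hlB : 0 < lB) (hlE : 0 < lE) {x : ℝ}
    (hx : 0 ≤ x) :
    HasDerivAt (divRate aB lB - divRate aE lE)
      (aB * Real.log (1 + aB * x / lB) - aE * Real.log (1 + aE * x / lE)) x :=
  (hasDerivAt_divRate haB hlB hx).sub (hasDerivAt_divRate haE hlE hx)

theorem sq_div_add_mul_le_sq_div_add_mul (haE : 0 < aE) (hlB : 0 < lB) (hlE : 0 < lE)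
    (hgain : aE ≤ aB) (hdark : lB / aB ≤ lE / aE) {x : ℝ} (hx : 0 ≤ x) :
    aE ^ 2 / (lE + aE * x) ≤ aB ^ 2 / (lB + aB * x) := by
  have haB : 0 < aB := haE.trans_le hgain
  calc aE ^ 2 / (lE + aE * x) = aE / (lE / aE + x) := by field_simp
    _ ≤ aB / (lB / aB + x) := by gcongr
    _ = aB ^ 2 / (lB + aB * x) := by field_simp

theorem convexOn_divRate_sub (haE : 0 < aE) (hlB : 0 < lB) (hlE : 0 < lE) (hgain : aE ≤ aB)
    (hdark : lB / aB ≤ lE / aE) : ConvexOn ℝ (Set.Ici 0) (divRate aB lB - divRate aE lE) := by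
  have haB : 0 < aB := haE.trans_le hgain
  have hderiv {x : ℝ} (hx : 0 ≤ x) := hasDerivAt_divRate_sub haB.le haE.le hlB hlE hx
  have hderiv2 {x : ℝ} (hx : 0 ≤ x) :=
    (hasDerivAt_mul_log haB.le hlB hx).sub (hasDerivAt_mul_log haE.le hlE hx)
  refine convexOn_of_hasDerivWithinAt2_nonneg (convex_Ici 0)
    (fun x hx => (hderiv hx).continuousAt.continuousWithinAt)
    (fun x hx => (hderiv (interior_subset hx)).hasDerivWithinAt)
    (fun x hx => (hderiv2 (interior_subset hx)).hasDerivWithinAt) fun x hx => ?_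
  exact sub_nonneg.2
    (sq_div_add_mul_le_sq_div_add_mul haE hlB hlE hgain hdark (interior_subset hx))

theorem divRate_sub_le (haE : 0 < aE) (hlB : 0 < lB) (hlE : 0 < lE) (hgain : aE ≤ aB)
    (hdark : lB / aB ≤ lE / aE) {x A : ℝ} (hx : 0 ≤ x) (hxA : x ≤ A) (hA : 0 < A) :
    divRate aB lB x - divRate aE lE x ≤ (divRate aB lB A - divRate aE lE A) / A * x := by
  have h := (convexOn_divRate_sub haE hlB hlE hgain hdark).2 (Set.mem_Ici.2 le_rfl)
    (Set.mem_Ici.2 hA.le) (sub_nonneg.2 ((div_le_one hA).2 hxA)) (div_nonneg hx hA.le) (by ring)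
  simp only [smul_eq_mul, mul_zero, zero_add, Pi.sub_apply, divRate_zero, sub_zero,
    div_mul_cancel₀ x hA.ne'] at h
  exact h.trans_eq (by ring)

theorem mul_log_lt_mul_log (haE : 0 < aE) (hlB : 0 < lB) (hlE : 0 < lE) (hgain : aE ≤ aB)
    (hdark : lB / aB ≤ lE / aE) (hstrict : aE < aB ∨ lB / aB < lE / aE) {x : ℝ} (hx : 0 < x) :
    aE * Real.log (1 + aE * x / lE) < aB * Real.log (1 + aB * x / lB) := by
  have haB : 0 < aB := haE.trans_le hgain
  have hratio {a l : ℝ} (ha : 0 < a) : a * x / l = x / (l / a) := by field_simp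
  have hlog : 0 < Real.log (1 + x / (lE / aE)) :=
    Real.log_pos (lt_add_of_pos_right 1 (by positivity))
  rw [hratio haE, hratio haB]
  rcases hstrict with hlt | hlt
  · calc aE * Real.log (1 + x / (lE / aE)) < aB * Real.log (1 + x / (lE / aE)) := by gcongr
      _ ≤ aB * Real.log (1 + x / (lB / aB)) := by gcongr
  · calc aE * Real.log (1 + x / (lE / aE)) ≤ aB * Real.log (1 + x / (lE / aE)) := by gcongr
      _ < aB * Real.log (1 + x / (lB / aB)) := by gcongr

theorem divRate_sub_pos (haE : 0 < aE) (hlB : 0 < lB) (hlE : 0 < lE) (hgain : aE ≤ aB)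
    (hdark : lB / aB ≤ lE / aE) (hstrict : aE < aB ∨ lB / aB < lE / aE) {A : ℝ} (hA : 0 < A) :
    0 < divRate aB lB A - divRate aE lE A := by
  have hderiv {x : ℝ} (hx : 0 ≤ x) :=
    hasDerivAt_divRate_sub (haE.le.trans hgain) haE.le hlB hlE hx
  have hmono : StrictMonoOn (divRate aB lB - divRate aE lE) (Set.Ici 0) := by
    refine strictMonoOn_of_deriv_pos (convex_Ici 0)
      (fun x hx => (hderiv hx).continuousAt.continuousWithinAt) fun x hx => ?_
    rw [(hderiv (interior_subset hx)).deriv, sub_pos]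
    rw [interior_Ici] at hx
    exact mul_log_lt_mul_log haE hlB hlE hgain hdark hstrict hx
  simpa [divRate_zero] using hmono (Set.mem_Ici.2 le_rfl) (Set.mem_Ici.2 hA.le) hA

theorem divRate_sub_div {A : ℝ} (hA : A ≠ 0) :
    (divRate aB lB A - divRate aE lE A) / A = (aB + lB / A) * Real.log (1 + aB * A / lB)
      - (aE + lE / A) * Real.log (1 + aE * A / lE) + (aE - aB) := by
  rw [divRate, divRate]
  field_simp
  ring

end Gap

section PoissonChannel

variable {a l Δ x : ℝ}

theorem poissonChannel_apply (a l Δ x : ℝ) :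
    poissonChannel a l Δ x = poissonMeasure ((a * x + l) * Δ).toNNReal := rfl

theorem poissonChannel_zero_singleton_ne_zero (a : ℝ) (hl : 0 < l) (hΔ : 0 < Δ) (k : ℕ) :
    poissonChannel a l Δ 0 {k} ≠ 0 := by
  have hmean : (0 : ℝ) < ((a * 0 + l) * Δ).toNNReal := by
    rw [mul_zero, zero_add, Real.coe_toNNReal _ (mul_pos hl hΔ).le]
    exact mul_pos hl hΔ
  rw [poissonChannel_apply, poissonMeasure_singleton, ne_eq, ENNReal.ofReal_eq_zero, not_le]
  positivity

theorem klDiv_poissonChannel (ha : 0 ≤ a) (hl : 0 < l) (hΔ : 0 < Δ) (hx : 0 ≤ x) :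
    klDiv (poissonChannel a l Δ x) (poissonChannel a l Δ 0)
      = ENNReal.ofReal (Δ * divRate a l x) := by
  have hratio : (a * x + l) * Δ / ((a * 0 + l) * Δ) = 1 + a * x / l := by
    field_simp
    ring
  rw [poissonChannel_apply, poissonChannel_apply, klDiv_poissonMeasure
    (Real.toNNReal_pos.2 (by positivity)) (Real.toNNReal_pos.2 (by positivity)),
    Real.coe_toNNReal _ (by positivity), Real.coe_toNNReal _ (by positivity), hratio, divRate]
  congr 1
  ring

theorem exists_degrading_kernel {aB lB aE lE Δ : ℝ} (haE : 0 < aE) (hlB : 0 ≤ lB) (hlE : 0 ≤ lE)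
    (hΔ : 0 ≤ Δ) (hgain : aE ≤ aB) (hdark : lB / aB ≤ lE / aE) :
    ∃ T : Kernel ℕ ℕ, IsMarkovKernel T ∧ ∀ x, 0 ≤ x →
      T ∘ₘ poissonChannel aB lB Δ x = poissonChannel aE lE Δ x := by
  have haB : 0 < aB := haE.trans_le hgain
  have hq0 : 0 ≤ aE / aB := by positivity
  have hq : aE / aB ∈ unitInterval := ⟨hq0, (div_le_one haB).2 hgain⟩
  have hc : 0 ≤ (lE - aE / aB * lB) * Δ := by
    rw [div_le_div_iff₀ haB haE] at hdark
    refine mul_nonneg ?_ hΔ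
    rw [sub_nonneg, div_mul_eq_mul_div, div_le_iff₀ haB]
    linarith
  refine ⟨poissonNoise ((lE - aE / aB * lB) * Δ).toNNReal ∘ₖ thinning ⟨_, hq⟩, inferInstance,
    fun x hx => ?_⟩
  rw [← Measure.comp_assoc, poissonChannel_apply, poissonChannel_apply,
    thinning_comp_poissonMeasure, poissonNoise_comp_poissonMeasure]
  congr 1
  ext
  rw [NNReal.coe_add, NNReal.coe_mul, Real.coe_toNNReal _ hq0,
    Real.coe_toNNReal _ (by positivity), Real.coe_toNNReal _ hc,
    Real.coe_toNNReal _ (by positivity)]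
  field_simp
  ring

end PoissonChannel

section Converse

theorem lintegral_ofReal_eq_of_ae_mem_Icc {α : Type*} [MeasurableSpace α] {μ : Measure α}
    [IsFiniteMeasure μ] {f : α → ℝ} (hf : AEStronglyMeasurable f μ) {A : ℝ}
    (h : ∀ᵐ x ∂μ, f x ∈ Set.Icc 0 A) :
    ∫⁻ x, ENNReal.ofReal (f x) ∂μ = ENNReal.ofReal (∫ x, f x ∂μ) := by
  refine (ofReal_integral_eq_lintegral_ofReal (Integrable.of_bound hf A ?_)
    (h.mono fun x hx => hx.1)).symm
  filter_upwards [h] with x hx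
  rw [Real.norm_eq_abs, abs_of_nonneg hx.1]
  exact hx.2

theorem lintegral_sum_ofReal_eq {ι : Type*} [Fintype ι] {μ : Measure (ι → ℝ)} [IsFiniteMeasure μ]
    {A : ℝ} (h : ∀ᵐ x ∂μ, ∀ i, x i ∈ Set.Icc 0 A) :
    ∫⁻ x, ∑ i, ENNReal.ofReal (x i) ∂μ = ENNReal.ofReal (∑ i, ∫ x, x i ∂μ) := by
  rw [lintegral_finsetSum _ fun i _ => by fun_prop,
    ENNReal.ofReal_sum_of_nonneg fun i _ => integral_nonneg_of_ae (h.mono fun x hx => (hx i).1)]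
  exact Finset.sum_congr rfl fun i _ => lintegral_ofReal_eq_of_ae_mem_Icc
    (measurable_pi_apply i).aestronglyMeasurable (h.mono fun x hx => hx i)

theorem measurableSet_forall_apply_mem {ι α : Type*} [Countable ι] [MeasurableSpace α] {s : Set α}
    (hs : MeasurableSet s) : MeasurableSet {x : ι → α | ∀ i, x i ∈ s} := by
  rw [Set.ofPred_forall]
  exact MeasurableSet.iInter fun i => measurable_pi_apply i hs

/-- On the inputs in `[0, A]` the channel `η` is a degraded version of `κ`, and the excess
divergence from the zero input of `κ` over `η` is at most `c` per unit of intensity. These are the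
properties of the two Poisson channels that the converse uses. -/
structure DegradedPair (κ η : Kernel ℝ ℕ) (A c : ℝ) : Prop where
  pos : 0 < A
  exists_kernel : ∃ T : Kernel ℕ ℕ, IsMarkovKernel T ∧ ∀ x ∈ Set.Icc 0 A, T ∘ₘ κ x = η x
  singleton_ne_zero_left : ∀ k, κ 0 {k} ≠ 0
  singleton_ne_zero_right : ∀ k, η 0 {k} ≠ 0
  bounded : ∃ D : ℝ≥0, ∀ x ∈ Set.Icc 0 A, klDiv (η x) (η 0) ≤ D
  gap : ∀ x ∈ Set.Icc 0 A,
    klDiv (κ x) (κ 0) ≤ klDiv (η x) (η 0) + ENNReal.ofReal c * ENNReal.ofReal x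

variable {κ η : Kernel ℝ ℕ} {A c : ℝ}

theorem lintegral_le_of_ae_le {α : Type*} [MeasurableSpace α] {μ : Measure α}
    [IsProbabilityMeasure μ] {f : α → ℝ≥0∞} {b : ℝ≥0∞} (h : ∀ᵐ x ∂μ, f x ≤ b) :
    ∫⁻ x, f x ∂μ ≤ b :=
  (lintegral_mono_ae h).trans_eq (by rw [lintegral_const, measure_univ, mul_one])

theorem memoryless_singleton_ne_zero [IsMarkovKernel κ] {n : ℕ} {x : Fin n → ℝ}
    (h : ∀ i k, κ (x i) {k} ≠ 0) (y : Fin n → ℕ) : memoryless κ n x {y} ≠ 0 := by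
  rw [memoryless_apply, Measure.pi_singleton]
  exact Finset.prod_ne_zero_iff.2 fun i _ => h i (y i)

theorem DegradedPair.lintegral_klDiv_memoryless_ne_top [IsMarkovKernel η]
    (h : DegradedPair κ η A c) {n : ℕ} {μ : Measure (Fin n → ℝ)} [IsProbabilityMeasure μ]
    (hμ : ∀ᵐ x ∂μ, ∀ i, x i ∈ Set.Icc 0 A) :
    ∫⁻ x, klDiv (memoryless η n x) (memoryless η n 0) ∂μ ≠ ∞ := by
  obtain ⟨D, hD⟩ := h.bounded
  refine ne_top_of_le_ne_top (b := ∑ _i : Fin n, (D : ℝ≥0∞))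
    (ENNReal.sum_ne_top.2 fun _ _ => ENNReal.coe_ne_top) (lintegral_le_of_ae_le ?_)
  filter_upwards [hμ] with x hx
  rw [klDiv_memoryless]
  exact Finset.sum_le_sum fun i _ => hD (x i) (hx i)

variable [IsMarkovKernel κ] [IsMarkovKernel η]

theorem DegradedPair.klDiv_memoryless_le (h : DegradedPair κ η A c) {n : ℕ} {x : Fin n → ℝ}
    (hx : ∀ i, x i ∈ Set.Icc 0 A) :
    klDiv (memoryless κ n x) (memoryless κ n 0) ≤ klDiv (memoryless η n x) (memoryless η n 0)
      + ENNReal.ofReal c * ∑ i, ENNReal.ofReal (x i) := by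
  rw [klDiv_memoryless, klDiv_memoryless, Finset.mul_sum, ← Finset.sum_add_distrib]
  exact Finset.sum_le_sum fun i _ => h.gap (x i) (hx i)

theorem DegradedPair.mutualInfo_memoryless_le (h : DegradedPair κ η A c) {W : Type*}
    [MeasurableSpace W] [StandardBorelSpace W] [Nonempty W] (U : Measure W)
    [IsProbabilityMeasure U] {n : ℕ} (enc : Kernel W (Fin n → ℝ)) [IsMarkovKernel enc]
    (henc : ∀ᵐ x ∂(enc ∘ₘ U), ∀ i, x i ∈ Set.Icc 0 A) :
    mutualInfo U (memoryless κ n ∘ₖ enc) ≤ mutualInfo U (memoryless η n ∘ₖ enc)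
      + ENNReal.ofReal c * ∫⁻ x, ∑ i, ENNReal.ofReal (x i) ∂(enc ∘ₘ U) := by
  obtain ⟨T, _, hT⟩ := h.exists_kernel
  have hT0 : productKernel T n ∘ₘ memoryless κ n 0 = memoryless η n 0 :=
    productKernel_comp_memoryless fun _ => hT 0 ⟨le_rfl, h.pos.le⟩
  refine mutualInfo_le_add_of_degraded U enc _ _ (productKernel T n)
    (henc.mono fun x hx => productKernel_comp_memoryless fun i => hT (x i) (hx i))
    (memoryless κ n 0) (fun x => ?_) (fun x => ?_) ?_ ?_
  · exact absolutelyContinuous_of_forall_singleton_ne_zero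
      (memoryless_singleton_ne_zero fun _ => h.singleton_ne_zero_left) _
  · rw [hT0]
    exact absolutelyContinuous_of_forall_singleton_ne_zero
      (memoryless_singleton_ne_zero fun _ => h.singleton_ne_zero_right) _
  · rw [hT0]
    exact h.lintegral_klDiv_memoryless_ne_top henc
  · rw [hT0, ← lintegral_const_mul _ (by fun_prop), ← lintegral_add_right _ (by fun_prop)]
    exact lintegral_mono_ae (henc.mono fun x hx => h.klDiv_memoryless_le hx)

variable {E : ℝ} {n M : ℕ}

theorem WiretapCode.ae_peak (C : WiretapCode A E n M) (U : Measure (Fin M)) :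
    ∀ᵐ x ∂(C.enc ∘ₘ U), ∀ i, x i ∈ Set.Icc 0 A :=
  Measure.ae_comp_of_ae_ae (measurableSet_forall_apply_mem measurableSet_Icc) (ae_of_all _ C.peak)

theorem WiretapCode.lintegral_sum_input_le [NeZero M] (C : WiretapCode A E n M) :
    ∫⁻ x, ∑ i, ENNReal.ofReal (x i) ∂(C.enc ∘ₘ uniformOn (Set.univ : Set (Fin M)))
      ≤ ENNReal.ofReal (n * E) := by
  have := C.markov
  have hpeak := C.ae_peak (uniformOn Set.univ)
  rw [lintegral_sum_ofReal_eq hpeak]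
  refine ENNReal.ofReal_le_ofReal ?_
  rcases n.eq_zero_or_pos with rfl | hn
  · simp
  · exact (div_le_iff₀' (Nat.cast_pos.2 hn)).1 C.average

theorem WiretapCode.log_card_mul_le [NeZero M] (C : WiretapCode A E n M)
    (h : DegradedPair κ η A c) :
    ENNReal.ofReal (Real.log M) * (1 - C.errorProb κ)
      ≤ C.leakage η + ENNReal.ofReal c * ENNReal.ofReal (n * E) + 1 := by
  have := C.markov
  have hfano := log_card_mul_le_mutualInfo_add_one (memoryless κ n ∘ₖ C.enc)
    (Measurable.of_discrete (f := C.dec))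
  rw [Fintype.card_fin] at hfano
  calc _ ≤ mutualInfo (uniformOn Set.univ) (memoryless κ n ∘ₖ C.enc) + 1 := hfano
    _ ≤ _ := by
      gcongr
      refine (h.mutualInfo_memoryless_le _ C.enc (C.ae_peak _)).trans ?_
      gcongr
      · exact le_rfl
      · exact C.lintegral_sum_input_le

theorem le_log_ceil_exp (t : ℝ) : t ≤ Real.log ⌈Real.exp t⌉₊ :=
  (Real.le_log_iff_exp_le (Nat.cast_pos.2 (Nat.ceil_pos.2 (Real.exp_pos t)))).2 (Nat.le_ceil _)

theorem le_div_add_of_natCast_mul_le {n : ℕ} (hn : n ≠ 0) {t x y : ℝ≥0∞}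
    (h : n * t ≤ x + n * y + 1) : t ≤ x / n + y + 1 / n := by
  have hn0 : (n : ℝ≥0∞) ≠ 0 := Nat.cast_ne_zero.2 hn
  have hn1 := ENNReal.natCast_ne_top n
  calc t ≤ (x + n * y + 1) / n := (ENNReal.le_div_iff_mul_le (.inl hn0) (.inl hn1)).2
        (by rwa [mul_comm])
    _ = _ := by
        rw [ENNReal.add_div, ENNReal.add_div, mul_comm (n : ℝ≥0∞) y,
          ENNReal.mul_div_cancel_right hn0 hn1]

theorem WiretapCode.rate_mul_le {Δ R : ℝ} (C : WiretapCode A E n ⌈Real.exp (n * Δ * R)⌉₊)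
    (h : DegradedPair κ η A c) (hn : n ≠ 0) :
    ENNReal.ofReal (Δ * R) * (1 - C.errorProb κ)
      ≤ C.leakage η / n + ENNReal.ofReal c * ENNReal.ofReal E + 1 / n := by
  have : NeZero ⌈Real.exp (n * Δ * R)⌉₊ := ⟨(Nat.ceil_pos.2 (Real.exp_pos _)).ne'⟩
  have hlog : n * (Δ * R) ≤ Real.log ⌈Real.exp (n * Δ * R)⌉₊ := by
    rw [← mul_assoc]
    exact le_log_ceil_exp _
  refine le_div_add_of_natCast_mul_le hn ?_
  calc (n : ℝ≥0∞) * (ENNReal.ofReal (Δ * R) * (1 - C.errorProb κ))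
      = ENNReal.ofReal (n * (Δ * R)) * (1 - C.errorProb κ) := by
        rw [← mul_assoc, ENNReal.ofReal_mul (Nat.cast_nonneg n), ENNReal.ofReal_natCast]
    _ ≤ ENNReal.ofReal (Real.log ⌈Real.exp (n * Δ * R)⌉₊) * (1 - C.errorProb κ) := by gcongr
    _ ≤ _ := C.log_card_mul_le h
    _ = _ := by
        rw [ENNReal.ofReal_mul (Nat.cast_nonneg n), ENNReal.ofReal_natCast, mul_left_comm]

theorem DegradedPair.le_of_mem_secureRates {Δ L R : ℝ} (h : DegradedPair κ η A (Δ * L))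
    (hΔ : 0 < Δ) (hL : 0 ≤ L) (hE : 0 ≤ E) (hR : R ∈ secureRates κ η Δ A E) : R ≤ L * E := by
  obtain ⟨-, C, herr, hleak⟩ := hR
  have hleft : Tendsto (fun n => ENNReal.ofReal (Δ * R) * (1 - (C n).errorProb κ)) atTop
      (𝓝 (ENNReal.ofReal (Δ * R) * (1 - 0))) :=
    ENNReal.Tendsto.const_mul
      (ENNReal.Tendsto.sub tendsto_const_nhds herr (.inl ENNReal.one_ne_top))
      (.inr ENNReal.ofReal_ne_top)
  have hinv : Tendsto (fun n : ℕ => (1 : ℝ≥0∞) / n) atTop (𝓝 0) := by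
    simpa only [one_div] using ENNReal.tendsto_inv_nat_nhds_zero
  have hright := (hleak.add (tendsto_const_nhds
    (x := ENNReal.ofReal (Δ * L) * ENNReal.ofReal E))).add hinv
  have hle := le_of_tendsto_of_tendsto hleft hright
    ((eventually_ne_atTop 0).mono fun n hn => (C n).rate_mul_le h hn)
  rw [tsub_zero, mul_one, zero_add, add_zero, ← ENNReal.ofReal_mul (by positivity),
    ENNReal.ofReal_le_ofReal_iff (by positivity), mul_assoc] at hle
  exact le_of_mul_le_mul_left hle hΔ

end Converse

section SingleLetter

variable {κ η : Kernel ℝ ℕ} {A c E : ℝ} {μ : Measure ℝ}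

theorem DegradedPair.lintegral_klDiv_ne_top (h : DegradedPair κ η A c) [IsProbabilityMeasure μ]
    (hμ : ∀ᵐ x ∂μ, x ∈ Set.Icc 0 A) : ∫⁻ x, klDiv (η x) (η 0) ∂μ ≠ ∞ := by
  obtain ⟨D, hD⟩ := h.bounded
  exact ne_top_of_le_ne_top ENNReal.coe_ne_top (lintegral_le_of_ae_le (hμ.mono hD))

theorem DegradedPair.mutualInfo_right_ne_top [IsMarkovKernel η]
    (h : DegradedPair κ η A c) (hμ : μ ∈ feasible A E) :
    mutualInfo μ η ≠ ∞ := by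
  obtain ⟨_, hpeak, -⟩ := hμ
  refine ne_top_of_le_ne_top (h.lintegral_klDiv_ne_top hpeak) ?_
  rw [lintegral_klDiv_eq_mutualInfo_add μ η (η 0) fun _ =>
    absolutelyContinuous_of_forall_singleton_ne_zero h.singleton_ne_zero_right _]
  exact le_self_add

variable [IsMarkovKernel κ] [IsMarkovKernel η]

theorem DegradedPair.mutualInfo_le (h : DegradedPair κ η A c) (hμ : μ ∈ feasible A E) :
    mutualInfo μ κ ≤ mutualInfo μ η + ENNReal.ofReal c * ENNReal.ofReal E := by
  obtain ⟨_, hpeak, hmean⟩ := hμ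
  obtain ⟨T, _, hT⟩ := h.exists_kernel
  have hT0 := hT 0 ⟨le_rfl, h.pos.le⟩
  have hκ0 := absolutelyContinuous_of_forall_singleton_ne_zero h.singleton_ne_zero_left
  have hη0 := absolutelyContinuous_of_forall_singleton_ne_zero h.singleton_ne_zero_right
  have hcost : ENNReal.ofReal c * ∫⁻ x, ENNReal.ofReal x ∂μ
      ≤ ENNReal.ofReal c * ENNReal.ofReal E := by
    rw [lintegral_ofReal_eq_of_ae_mem_Icc (f := fun x => x)
      measurable_id.aestronglyMeasurable hpeak]
    gcongr
  have hgap : ∫⁻ x, klDiv (κ x) (κ 0) ∂μ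
      ≤ ∫⁻ x, klDiv (η x) (η 0) ∂μ + ENNReal.ofReal c * ENNReal.ofReal E := by
    refine le_trans ?_ (add_le_add_right hcost _)
    rw [← lintegral_const_mul _ (by fun_prop), ← lintegral_add_right _ (by fun_prop)]
    exact lintegral_mono_ae (hpeak.mono h.gap)
  have key := mutualInfo_le_add_of_degraded μ Kernel.id κ η T
    (by rw [Measure.id_comp]; exact hpeak.mono hT) (κ 0) (fun x => hκ0 _)
    (fun x => by rw [hT0]; exact hη0 _)
    (by rw [hT0, Measure.id_comp]; exact h.lintegral_klDiv_ne_top hpeak)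
    (by rw [hT0, Measure.id_comp]; exact hgap)
  rwa [Kernel.comp_id, Kernel.comp_id] at key

theorem DegradedPair.mutualInfo_left_ne_top (h : DegradedPair κ η A c) (hμ : μ ∈ feasible A E) :
    mutualInfo μ κ ≠ ∞ :=
  ne_top_of_le_ne_top (ENNReal.add_ne_top.2 ⟨h.mutualInfo_right_ne_top hμ,
    ENNReal.mul_ne_top ENNReal.ofReal_ne_top ENNReal.ofReal_ne_top⟩) (h.mutualInfo_le hμ)

theorem DegradedPair.infoDiff_le {Δ L : ℝ} (h : DegradedPair κ η A (Δ * L)) (hΔ : 0 < Δ)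
    (hL : 0 ≤ L) (hE : 0 ≤ E) (hμ : μ ∈ feasible A E) : infoDiff κ η Δ μ ≤ L * E := by
  have hη := h.mutualInfo_right_ne_top hμ
  have hle := h.mutualInfo_le hμ
  rw [← ENNReal.ofReal_mul (by positivity)] at hle
  replace hle := ENNReal.toReal_mono (ENNReal.add_ne_top.2 ⟨hη, ENNReal.ofReal_ne_top⟩) hle
  rw [ENNReal.toReal_add hη ENNReal.ofReal_ne_top, ENNReal.toReal_ofReal (by positivity)] at hle
  rw [infoDiff, div_le_iff₀' hΔ]
  linarith

end SingleLetter

section TypicalSet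

variable {α : Type*} [MeasurableSpace α]

theorem ae_tendsto_sum_range_div_infinitePi (P : Measure α) [IsProbabilityMeasure P] {f : α → ℝ}
    (hf : Measurable f) (hint : Integrable f P) :
    ∀ᵐ ω ∂Measure.infinitePi fun _ : ℕ => P,
      Tendsto (fun n : ℕ => (∑ i ∈ Finset.range n, f (ω i)) / n) atTop (𝓝 (∫ a, f a ∂P)) := by
  set Q := Measure.infinitePi fun _ : ℕ => P
  have hev (i : ℕ) : MeasurePreserving (fun ω : ℕ → α => ω i) Q P :=
    measurePreserving_eval_infinitePi _ i
  have hident (i : ℕ) : IdentDistrib (fun ω => f (ω i)) (fun ω => f (ω 0)) Q Q := by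
    refine IdentDistrib.comp (u := f) ⟨?_, ?_, ?_⟩ hf
    · exact (hev i).measurable.aemeasurable
    · exact (hev 0).measurable.aemeasurable
    · rw [(hev i).map_eq, (hev 0).map_eq]
  have h := strong_law_ae_real (fun i (ω : ℕ → α) => f (ω i))
    ((hev 0).integrable_comp_of_integrable hint)
    (fun i j hij => (iIndepFun_infinitePi fun _ => hf).indepFun hij) hident
  rwa [← (hev 0).map_eq, integral_map (hev 0).measurable.aemeasurable
    hf.aestronglyMeasurable]

theorem tendsto_pi_sum_le_zero (P : Measure α) [IsProbabilityMeasure P] {f : α → ℝ}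
    (hf : Measurable f) (hint : Integrable f P) {r : ℝ} (hr : r < ∫ a, f a ∂P) :
    Tendsto (fun n : ℕ => Measure.pi (fun _ : Fin n => P) {z | ∑ i, f (z i) ≤ n * r}) atTop
      (𝓝 0) := by
  set Q := Measure.infinitePi fun _ : ℕ => P
  have hprob := tendstoInMeasure_iff_dist.1 (tendstoInMeasure_of_tendsto_ae
    (fun n => (by fun_prop : Measurable fun ω : ℕ → α =>
      (∑ i ∈ Finset.range n, f (ω i)) / n).aestronglyMeasurable)
    (ae_tendsto_sum_range_div_infinitePi P hf hint)) _ (sub_pos.2 hr)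
  refine tendsto_of_tendsto_of_tendsto_of_le_of_le' tendsto_const_nhds hprob
    (.of_forall fun _ => zero_le) ((eventually_gt_atTop 0).mono fun n hn => ?_)
  have hpi : Measure.pi (fun _ : Fin n => P) = Q.map fun ω (i : Fin n) => ω i := by
    rw [Measure.map_infinitePi_infinitePi_of_inj Fin.val_injective, Measure.infinitePi_eq_pi]
  rw [hpi, Measure.map_apply (by fun_prop) (measurableSet_le (by fun_prop) measurable_const)]
  refine measure_mono fun ω (hω : ∑ i : Fin n, f (ω i) ≤ n * r) => ?_
  rw [Fin.sum_univ_eq_sum_range fun i => f (ω i), ← div_le_iff₀' (Nat.cast_pos.2 hn)] at hω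
  change _ ≤ dist _ _
  rw [dist_comm]
  exact (sub_le_sub_left hω _).trans (le_abs_self _)

/-- The words of length `n` whose likelihood ratio of `P` to `Q` exceeds `exp t`: the jointly
typical set of the decoder, for `P` the law of an input and its output and `Q` the product of their
laws. -/
def typicalSet (P Q : Measure α) (n : ℕ) (t : ℝ) : Set (Fin n → α) :=
  {z | ENNReal.ofReal (Real.exp t) < ∏ i, P.rnDeriv Q (z i)}

variable (P Q : Measure α)

theorem measurable_prod_rnDeriv (n : ℕ) :
    Measurable fun z : Fin n → α => ∏ i, P.rnDeriv Q (z i) :=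
  Finset.measurable_prod _ fun i _ =>
    (Measure.measurable_rnDeriv P Q).comp (measurable_pi_apply i)

theorem measurableSet_typicalSet (n : ℕ) (t : ℝ) : MeasurableSet (typicalSet P Q n t) :=
  measurableSet_lt measurable_const (measurable_prod_rnDeriv P Q n)

variable [IsProbabilityMeasure P] [IsProbabilityMeasure Q]

theorem pi_typicalSet_le (n : ℕ) (t : ℝ) :
    Measure.pi (fun _ : Fin n => Q) (typicalSet P Q n t) ≤ ENNReal.ofReal (Real.exp (-t)) := by
  have hmean : ∫⁻ z, ∏ i, P.rnDeriv Q (z i) ∂Measure.pi (fun _ : Fin n => Q) ≤ 1 := by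
    rw [lintegral_prod_pi _ fun _ => Measure.measurable_rnDeriv P Q]
    exact Finset.prod_le_one' fun _ _ => (Measure.lintegral_rnDeriv_le).trans_eq measure_univ
  have hsub : typicalSet P Q n t ⊆
      {z | ENNReal.ofReal (Real.exp t) ≤ ∏ i, P.rnDeriv Q (z i)} :=
    fun _ (hz : ENNReal.ofReal _ < _) => hz.le
  have hmarkov := (mul_meas_ge_le_lintegral (measurable_prod_rnDeriv P Q n)
    (ENNReal.ofReal (Real.exp t))).trans hmean
  rw [Real.exp_neg, ENNReal.ofReal_inv_of_pos (Real.exp_pos t), ENNReal.le_inv_iff_mul_le, mul_comm]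
  exact (mul_le_mul_right (measure_mono hsub) _).trans hmarkov

theorem tendsto_pi_compl_typicalSet (hfin : klDiv P Q ≠ ∞) {r : ℝ} (hr : r < (klDiv P Q).toReal) :
    Tendsto (fun n : ℕ => Measure.pi (fun _ : Fin n => P) (typicalSet P Q n (n * r))ᶜ) atTop
      (𝓝 0) := by
  obtain ⟨hac, hint⟩ := klDiv_ne_top_iff.1 hfin
  rw [toReal_klDiv_of_measure_eq hac (by rw [measure_univ, measure_univ])] at hr
  refine tendsto_of_tendsto_of_tendsto_of_le_of_le tendsto_const_nhds
    (tendsto_pi_sum_le_zero P (measurable_llr P Q) hint hr) (fun _ => zero_le) fun n => ?_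
  have hpos : ∀ᵐ z ∂Measure.pi (fun _ : Fin n => P), ∀ i,
      P.rnDeriv Q (z i) ≠ 0 ∧ P.rnDeriv Q (z i) ≠ ∞ := by
    refine ae_all_iff.2 fun i => ?_
    have hone : ∀ᵐ a ∂P, P.rnDeriv Q a ≠ 0 ∧ P.rnDeriv Q a ≠ ∞ :=
      ((Measure.rnDeriv_pos hac).mono fun _ h => h.ne').and
        (hac.ae_le (Measure.rnDeriv_ne_top P Q))
    exact (measurePreserving_eval (fun _ : Fin n => P) i).quasiMeasurePreserving.ae hone
  refine measure_mono_ae ?_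
  filter_upwards [hpos] with z hz (hnot : ¬ ENNReal.ofReal _ < _)
  have hprod : ∏ i, P.rnDeriv Q (z i) = ENNReal.ofReal (Real.exp (∑ i, llr P Q (z i))) := by
    rw [Real.exp_sum, ENNReal.ofReal_prod_of_nonneg fun _ _ => (Real.exp_pos _).le]
    refine Finset.prod_congr rfl fun i _ => ?_
    rw [llr, Real.exp_log (ENNReal.toReal_pos (hz i).1 (hz i).2), ENNReal.ofReal_toReal (hz i).2]
  rwa [hprod, ENNReal.ofReal_lt_ofReal_iff (Real.exp_pos _), Real.exp_lt_exp, not_lt] at hnot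

end TypicalSet

section RandomCoding

variable {α β ι : Type*} [MeasurableSpace α] [MeasurableSpace β]

/-- The decoder that picks a codeword of the codebook `c` which is jointly typical with the output,
typicality being membership in `T`; the choice is arbitrary if there are several or none. -/
noncomputable def typicalDecoder [Nonempty ι] (T : Set (α × β)) (c : ι → α) (y : β) : ι :=
  Classical.epsilon fun i => (c i, y) ∈ T

theorem measurable_kernel_codeword (κ : Kernel α β) [IsSFiniteKernel κ] {T : Set (α × β)}
    (hT : MeasurableSet T) (i j : ι) :
    Measurable fun c : ι → α => κ (c i) {y | (c j, y) ∈ T} :=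
  Kernel.measurable_kernel_prodMk_left (κ := κ.comap (fun c : ι → α => c i) (measurable_pi_apply i))
    (t := {p | (p.1 j, p.2) ∈ T}) (hT.preimage (by fun_prop))

variable [Fintype ι]

theorem lintegral_kernel_codeword_self (μ : Measure α) [IsProbabilityMeasure μ] (κ : Kernel α β)
    [IsSFiniteKernel κ] {T : Set (α × β)} (hT : MeasurableSet T) (i : ι) :
    ∫⁻ c, κ (c i) {y | (c i, y) ∈ T} ∂Measure.pi (fun _ : ι => μ) = (μ ⊗ₘ κ) T := by
  rw [Measure.compProd_apply hT]
  exact (measurePreserving_eval (fun _ : ι => μ) i).lintegral_comp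
    (Kernel.measurable_kernel_prodMk_left hT)

theorem lintegral_kernel_codeword_of_ne (μ : Measure α) [IsProbabilityMeasure μ] (κ : Kernel α β)
    [IsMarkovKernel κ] {T : Set (α × β)} (hT : MeasurableSet T) {i j : ι} (hij : i ≠ j) :
    ∫⁻ c, κ (c i) {y | (c j, y) ∈ T} ∂Measure.pi (fun _ : ι => μ) = (μ.prod (κ ∘ₘ μ)) T := by
  have hmeas : Measurable fun p : α × α => κ p.1 (Prod.mk p.2 ⁻¹' T) :=
    Kernel.measurable_kernel_prodMk_left (κ := κ.comap Prod.fst measurable_fst)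
      (t := {p : (α × α) × β | (p.1.2, p.2) ∈ T}) (hT.preimage (by fun_prop))
  calc ∫⁻ c, κ (c i) {y | (c j, y) ∈ T} ∂Measure.pi (fun _ : ι => μ)
      = ∫⁻ p, κ p.1 (Prod.mk p.2 ⁻¹' T) ∂μ.prod μ := by
        rw [← Measure.infinitePi_eq_pi,
            ← Measure.infinitePi_map_eval_prod (P := fun _ : ι => μ) hij,
          lintegral_map hmeas (by fun_prop)]
        rfl
    _ = ∫⁻ x', ∫⁻ x, κ x (Prod.mk x' ⁻¹' T) ∂μ ∂μ := lintegral_prod_symm' _ hmeas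
    _ = (μ.prod (κ ∘ₘ μ)) T := by
        rw [Measure.prod_apply hT]
        exact lintegral_congr fun x' =>
          (Measure.bind_apply (measurable_prodMk_left hT) κ.aemeasurable).symm

variable [DecidableEq ι]

/-- The union bound on the error probability of `typicalDecoder` when the codeword `c i` is sent. -/
noncomputable def packingError (κ : Kernel α β) (T : Set (α × β)) (c : ι → α) (i : ι) : ℝ≥0∞ :=
  κ (c i) {y | (c i, y) ∉ T} + ∑ j ∈ Finset.univ.erase i, κ (c i) {y | (c j, y) ∈ T}

theorem measure_typicalDecoder_ne_le [Nonempty ι] (κ : Kernel α β) (T : Set (α × β)) (c : ι → α)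
    (i : ι) : κ (c i) {y | typicalDecoder T c y ≠ i} ≤ packingError κ T c i := by
  have hsub : {y | typicalDecoder T c y ≠ i} ⊆
      {y | (c i, y) ∉ T} ∪ ⋃ j ∈ Finset.univ.erase i, {y | (c j, y) ∈ T} := by
    intro y (hy : typicalDecoder T c y ≠ i)
    by_cases hi : (c i, y) ∈ T
    · exact .inr (Set.mem_biUnion (Finset.mem_erase.2 ⟨hy, Finset.mem_univ _⟩)
        (Classical.epsilon_spec (p := fun j => (c j, y) ∈ T) ⟨i, hi⟩))
    · exact .inl hi
  exact (measure_mono hsub).trans ((measure_union_le _ _).trans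
    (add_le_add_right (measure_biUnion_finset_le _ _) _))

theorem measurable_packingError (κ : Kernel α β) [IsSFiniteKernel κ] {T : Set (α × β)}
    (hT : MeasurableSet T) (i : ι) : Measurable fun c : ι → α => packingError κ T c i :=
  (measurable_kernel_codeword κ hT.compl i i).add
    (Finset.measurable_sum _ fun j _ => measurable_kernel_codeword κ hT i j)

/-- The expected `packingError` of a random codebook of `N` independent words of law `μ`. -/
noncomputable def meanPackingError (μ : Measure α) (κ : Kernel α β) (T : Set (α × β)) (N : ℕ) :
    ℝ≥0∞ :=
  (μ ⊗ₘ κ) Tᶜ + (N - 1 : ℕ) * (μ.prod (κ ∘ₘ μ)) T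

theorem lintegral_packingError (μ : Measure α) [IsProbabilityMeasure μ] (κ : Kernel α β)
    [IsMarkovKernel κ] {T : Set (α × β)} (hT : MeasurableSet T) (i : ι) :
    ∫⁻ c, packingError κ T c i ∂Measure.pi (fun _ : ι => μ)
      = meanPackingError μ κ T (Fintype.card ι) := by
  have hself : Measurable fun c : ι → α => κ (c i) {y | (c i, y) ∉ T} :=
    measurable_kernel_codeword κ hT.compl i i
  unfold packingError
  rw [lintegral_add_left hself,
    lintegral_finsetSum _ fun j _ => measurable_kernel_codeword κ hT i j,
    Finset.sum_congr rfl fun j hj =>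
      lintegral_kernel_codeword_of_ne μ κ hT (Finset.ne_of_mem_erase hj).symm,
    Finset.sum_const, Finset.card_erase_of_mem (Finset.mem_univ i), Finset.card_univ, nsmul_eq_mul]
  exact congrArg (· + _) (lintegral_kernel_codeword_self μ κ hT.compl i)

end RandomCoding

section CodebookEncoder

variable {α β W V : Type*} [MeasurableSpace α] [MeasurableSpace β] [Countable W]
  [MeasurableSpace W] [MeasurableSingletonClass W] [MeasurableSpace V]

/-- Wyner's stochastic encoder: the message `w` is sent as a uniformly chosen word of the
sub-codebook `fun v => c (w, v)`. -/
noncomputable def codebookEncoder (c : W × V → α) : Kernel W α :=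
  Kernel.ofFunOfCountable fun w => (uniformOn (Set.univ : Set V)).map fun v => c (w, v)

theorem codebookEncoder_apply (c : W × V → α) (w : W) :
    codebookEncoder c w = (uniformOn (Set.univ : Set V)).map fun v => c (w, v) := rfl

variable [DiscreteMeasurableSpace V]

instance [Finite V] [Nonempty V] (c : W × V → α) : IsMarkovKernel (codebookEncoder c) :=
  ⟨fun w => Measure.isProbabilityMeasure_map (μ := uniformOn (Set.univ : Set V))
    (f := fun v => c (w, v)) Measurable.of_discrete.aemeasurable⟩

theorem lintegral_codebookEncoder_comp (c : W × V → α) {f : α → ℝ≥0∞} (hf : Measurable f) :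
    ∫⁻ x, f x ∂(codebookEncoder c ∘ₘ uniformOn (Set.univ : Set W))
      = ∫⁻ w, ∫⁻ v, f (c (w, v)) ∂uniformOn (Set.univ : Set V) ∂uniformOn (Set.univ : Set W) := by
  rw [Measure.lintegral_bind (Kernel.aemeasurable _) hf.aemeasurable]
  exact lintegral_congr fun w => lintegral_map hf Measurable.of_discrete

theorem comp_codebookEncoder_apply (c : W × V → α) (κ : Kernel α β) (w : W) :
    (κ ∘ₖ codebookEncoder c) w
      = κ.comap (fun v => c (w, v)) .of_discrete ∘ₘ uniformOn (Set.univ : Set V) := by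
  refine Measure.ext fun s hs => ?_
  rw [Kernel.comp_apply' _ _ _ hs, codebookEncoder_apply,
    lintegral_map (κ.measurable_coe hs) .of_discrete, Measure.bind_apply hs (Kernel.aemeasurable _)]
  rfl

theorem compProd_codebookEncoder_ne_le {W : Type*} [Fintype W] [DecidableEq W] [Nonempty W]
    [MeasurableSpace W] [MeasurableSingletonClass W] [Fintype V] [DecidableEq V] [Nonempty V]
    (c : W × V → α) (κ : Kernel α β) [IsMarkovKernel κ] (T : Set (α × β))
    (hdec : Measurable (typicalDecoder T c)) :
    (uniformOn (Set.univ : Set W) ⊗ₘ (κ ∘ₖ codebookEncoder c))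
        {p | (typicalDecoder T c p.2).1 ≠ p.1}
      ≤ ∫⁻ w, ∫⁻ v, packingError κ T c (w, v)
        ∂uniformOn (Set.univ : Set V) ∂uniformOn (Set.univ : Set W) := by
  have hs : MeasurableSet {p : W × β | (typicalDecoder T c p.2).1 ≠ p.1} :=
    (measurableSet_eq_fun (measurable_fst.comp (hdec.comp measurable_snd)) measurable_fst).compl
  rw [Measure.compProd_apply hs]
  refine lintegral_mono fun w => ?_
  rw [comp_codebookEncoder_apply, Measure.bind_apply (measurable_prodMk_left hs)
    (Kernel.aemeasurable _)]
  refine lintegral_mono fun v => (measure_mono ?_).trans (measure_typicalDecoder_ne_le κ T c (w, v))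
  exact fun y (hy : (typicalDecoder T c y).1 ≠ w) heq => hy (congrArg Prod.fst heq)

end CodebookEncoder

section Leakage

variable {α β W V : Type*} [MeasurableSpace α] [MeasurableSpace β] [Fintype V] [DecidableEq V]
  [Nonempty V] [MeasurableSpace V] [MeasurableSingletonClass V] [Countable β]
  [DiscreteMeasurableSpace β]

theorem log_card_le_mutualInfo_add_packingError (c : V → α) (κ : Kernel α β) [IsMarkovKernel κ]
    (T : Set (α × β)) :
    ENNReal.ofReal (Real.log (Fintype.card V))
      ≤ mutualInfo (uniformOn (Set.univ : Set V)) (κ.comap c .of_discrete)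
        + ENNReal.ofReal (Real.log (Fintype.card V))
          * ∫⁻ v, packingError κ T c v ∂uniformOn (Set.univ : Set V) + 1 := by
  set U := uniformOn (Set.univ : Set V)
  set l := ENNReal.ofReal (Real.log (Fintype.card V))
  have hdec : Measurable (typicalDecoder T c) := .of_discrete
  have herr : (U ⊗ₘ κ.comap c .of_discrete) {p | typicalDecoder T c p.2 ≠ p.1}
      ≤ ∫⁻ v, packingError κ T c v ∂U := by
    rw [Measure.compProd_apply .of_discrete]
    exact lintegral_mono fun v => measure_typicalDecoder_ne_le κ T c v
  calc l = l * 1 := (mul_one l).symm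
    _ ≤ l * ((1 - (U ⊗ₘ κ.comap c .of_discrete) {p | typicalDecoder T c p.2 ≠ p.1})
          + ∫⁻ v, packingError κ T c v ∂U) := by
        gcongr
        exact le_tsub_add.trans (add_le_add_right herr _)
    _ ≤ _ := by
        rw [mul_add, add_right_comm]
        exact add_le_add_left (log_card_mul_le_mutualInfo_add_one _ hdec) _

variable [Finite W] [Nonempty W] [MeasurableSpace W] [MeasurableSingletonClass W]

theorem mutualInfo_codebookEncoder_add_log_card_le (c : W × V → α) (κ : Kernel α β)
    [IsMarkovKernel κ] (T : Set (α × β)) (ν : Measure β) [IsProbabilityMeasure ν]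
    (hac : ∀ x, κ x ≪ ν) :
    mutualInfo (uniformOn (Set.univ : Set W)) (κ ∘ₖ codebookEncoder c)
        + ENNReal.ofReal (Real.log (Fintype.card V))
      ≤ ∫⁻ w, ∫⁻ v, klDiv (κ (c (w, v))) ν
          ∂uniformOn (Set.univ : Set V) ∂uniformOn (Set.univ : Set W)
        + ENNReal.ofReal (Real.log (Fintype.card V))
          * ∫⁻ w, ∫⁻ v, packingError κ T (fun v => c (w, v)) v
            ∂uniformOn (Set.univ : Set V) ∂uniformOn (Set.univ : Set W) + 1 := by
  set U := uniformOn (Set.univ : Set W)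
  set l := ENNReal.ofReal (Real.log (Fintype.card V))
  let κw (w : W) : Kernel V β := κ.comap (fun v => c (w, v)) .of_discrete
  let J (w : W) := mutualInfo (uniformOn (Set.univ : Set V)) (κw w)
  let e (w : W) := ∫⁻ v, packingError κ T (fun v => c (w, v)) v ∂uniformOn (Set.univ : Set V)
  have hcomp (w : W) : (κ ∘ₖ codebookEncoder c) w ≪ ν := by
    rw [Kernel.comp_apply]
    exact comp_absolutelyContinuous (ae_of_all _ hac)
  have hchain (w : W) : ∫⁻ v, klDiv (κ (c (w, v))) ν ∂uniformOn (Set.univ : Set V)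
      = J w + klDiv ((κ ∘ₖ codebookEncoder c) w) ν := by
    rw [comp_codebookEncoder_apply]
    exact lintegral_klDiv_eq_mutualInfo_add _ (κw w) ν fun v => hac _
  have hlog : l ≤ ∫⁻ w, J w ∂U + l * ∫⁻ w, e w ∂U + 1 :=
    calc l = ∫⁻ _, l ∂U := by rw [lintegral_const, measure_univ, mul_one]
      _ ≤ ∫⁻ w, (J w + l * e w + 1) ∂U :=
        lintegral_mono fun w => log_card_le_mutualInfo_add_packingError _ κ T
      _ = _ := by
        rw [lintegral_add_right _ .of_discrete, lintegral_add_right _ .of_discrete,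
          lintegral_const_mul _ .of_discrete, lintegral_one, measure_univ]
  calc _ ≤ mutualInfo U (κ ∘ₖ codebookEncoder c) + (∫⁻ w, J w ∂U + l * ∫⁻ w, e w ∂U + 1) :=
        add_le_add_right hlog _
    _ = (∫⁻ w, J w ∂U + mutualInfo U (κ ∘ₖ codebookEncoder c)) + l * ∫⁻ w, e w ∂U + 1 := by ring
    _ ≤ _ := by
        refine add_le_add_left (add_le_add_left ?_ _) _
        rw [lintegral_congr hchain, lintegral_add_right _ .of_discrete,
          lintegral_klDiv_eq_mutualInfo_add U _ ν hcomp]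
        exact add_le_add_right le_self_add _

end Leakage

section Average

variable {Ω W V : Type*} [MeasurableSpace Ω] [MeasurableSpace W] [MeasurableSpace V]
  [Countable W] [MeasurableSingletonClass W] [Countable V] [MeasurableSingletonClass V]

theorem measurable_lintegral_of_countable {f : Ω → W → ℝ≥0∞} (hf : ∀ w, Measurable fun ω => f ω w)
    (U : Measure W) [SFinite U] : Measurable fun ω => ∫⁻ w, f ω w ∂U :=
  Measurable.lintegral_prod_right' (f := fun p : Ω × W => f p.1 p.2)
    (measurable_from_prod_countable_left hf)

theorem lintegral_lintegral_le_of_countable (P : Measure Ω) [SFinite P] (U : Measure W)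
    [IsProbabilityMeasure U] {f : Ω → W → ℝ≥0∞} (hf : ∀ w, Measurable fun ω => f ω w) {b : ℝ≥0∞}
    (h : ∀ w, ∫⁻ ω, f ω w ∂P ≤ b) : ∫⁻ ω, ∫⁻ w, f ω w ∂U ∂P ≤ b := by
  rw [lintegral_lintegral_swap (measurable_from_prod_countable_left hf).aemeasurable]
  exact lintegral_le_of_ae_le (ae_of_all _ h)

theorem lintegral_lintegral_lintegral_le_of_countable (P : Measure Ω) [SFinite P] (U : Measure W)
    [IsProbabilityMeasure U] (U' : Measure V) [IsProbabilityMeasure U'] {f : Ω → W → V → ℝ≥0∞}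
    (hf : ∀ w v, Measurable fun ω => f ω w v) {b : ℝ≥0∞} (h : ∀ w v, ∫⁻ ω, f ω w v ∂P ≤ b) :
    ∫⁻ ω, ∫⁻ w, ∫⁻ v, f ω w v ∂U' ∂U ∂P ≤ b :=
  lintegral_lintegral_le_of_countable P U (fun w => measurable_lintegral_of_countable (hf w) U')
    fun w => lintegral_lintegral_le_of_countable P U' (hf w) (h w)

end Average

section OneShot

theorem measurePreserving_comp_pi_of_injective {α ι V : Type*} [MeasurableSpace α] [Fintype ι]
    [Fintype V] (μ : Measure α) [IsProbabilityMeasure μ] {f : V → ι} (hf : f.Injective) :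
    MeasurePreserving (fun (c : ι → α) v => c (f v)) (Measure.pi fun _ => μ)
      (Measure.pi fun _ => μ) := by
  refine ⟨by fun_prop, ?_⟩
  rw [← Measure.infinitePi_eq_pi, ← Measure.infinitePi_eq_pi,
    Measure.map_infinitePi_infinitePi_of_inj hf]

variable {α β W V : Type*} [MeasurableSpace α] [MeasurableSpace β]

section Subcodebook

variable [Fintype V] [DecidableEq V]

theorem measurable_packingError_subcodebook (κ : Kernel α β) [IsMarkovKernel κ]
    {T : Set (α × β)} (hT : MeasurableSet T) (w : W) (v : V) :
    Measurable fun c : W × V → α => packingError κ T (fun v => c (w, v)) v :=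
  (measurable_packingError κ hT v).comp (f := fun (c : W × V → α) v => c (w, v)) (by fun_prop)

theorem lintegral_packingError_subcodebook [Fintype W] (μ : Measure α) [IsProbabilityMeasure μ]
    (κ : Kernel α β) [IsMarkovKernel κ] {T : Set (α × β)} (hT : MeasurableSet T) (w : W) (v : V) :
    ∫⁻ c, packingError κ T (fun v => c (w, v)) v ∂Measure.pi (fun _ : W × V => μ)
      = meanPackingError μ κ T (Fintype.card V) := by
  rw [← lintegral_packingError μ κ hT v]
  exact (measurePreserving_comp_pi_of_injective μ (Prod.mk_right_injective w)).lintegral_comp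
    (measurable_packingError κ hT v)

end Subcodebook

variable [MeasurableSpace W] [MeasurableSingletonClass W] [MeasurableSpace V]
  [MeasurableSingletonClass V]

theorem measurable_lintegral_codeword [Countable W] [Countable V] {f : α → ℝ≥0∞}
    (hf : Measurable f) :
    Measurable fun c : W × V → α => ∫⁻ w, ∫⁻ v, f (c (w, v))
      ∂uniformOn (Set.univ : Set V) ∂uniformOn (Set.univ : Set W) :=
  measurable_lintegral_of_countable (fun w => measurable_lintegral_of_countable
    (fun v => hf.comp (measurable_pi_apply (w, v))) _) _

variable [Fintype W] [Nonempty W] [Fintype V] [Nonempty V]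

theorem lintegral_lintegral_codeword_le (μ : Measure α) [IsProbabilityMeasure μ] {f : α → ℝ≥0∞}
    (hf : Measurable f) :
    ∫⁻ c, ∫⁻ w, ∫⁻ v, f (c (w, v)) ∂uniformOn (Set.univ : Set V) ∂uniformOn (Set.univ : Set W)
      ∂Measure.pi (fun _ : W × V => μ) ≤ ∫⁻ x, f x ∂μ :=
  lintegral_lintegral_lintegral_le_of_countable _ _ _
    (fun w v => hf.comp (measurable_pi_apply (w, v))) fun w v =>
      ((measurePreserving_eval (fun _ : W × V => μ) (w, v)).lintegral_comp hf).le

variable [Countable β] [DiscreteMeasurableSpace β]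

theorem exists_measurable_mutualInfo_codebookEncoder_le [StandardBorelSpace α] [Nonempty α]
    (μ : Measure α) [IsProbabilityMeasure μ] (η : Kernel α β) [IsMarkovKernel η]
    (hac : ∀ x, η x ≪ η ∘ₘ μ) {T : Set (α × β)} (hT : MeasurableSet T) :
    ∃ X : (W × V → α) → ℝ≥0∞, Measurable X ∧
      (∀ c, mutualInfo (uniformOn (Set.univ : Set W)) (η ∘ₖ codebookEncoder c) ≤ X c) ∧
      ∫⁻ c, X c ∂Measure.pi (fun _ => μ) + ENNReal.ofReal (Real.log (Fintype.card V))
        ≤ mutualInfo μ η + ENNReal.ofReal (Real.log (Fintype.card V))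
            * meanPackingError μ η T (Fintype.card V) + 1 := by
  classical
  set l := ENNReal.ofReal (Real.log (Fintype.card V))
  let D (c : W × V → α) := ∫⁻ w, ∫⁻ v, klDiv (η (c (w, v))) (η ∘ₘ μ)
    ∂uniformOn (Set.univ : Set V) ∂uniformOn (Set.univ : Set W)
  let e (c : W × V → α) := ∫⁻ w, ∫⁻ v, packingError η T (fun v => c (w, v)) v
    ∂uniformOn (Set.univ : Set V) ∂uniformOn (Set.univ : Set W)
  have hkl : Measurable fun x => klDiv (η x) (η ∘ₘ μ) :=
    measurable_klDiv_kernel (η := Kernel.const α (η ∘ₘ μ)) hac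
  have hle (c : W × V → α) := mutualInfo_codebookEncoder_add_log_card_le c η T (η ∘ₘ μ) hac
  have hDm : Measurable D := measurable_lintegral_codeword hkl
  have hem : Measurable e := measurable_lintegral_of_countable (fun w =>
    measurable_lintegral_of_countable (measurable_packingError_subcodebook η hT w) _) _
  have hD : ∫⁻ c, D c ∂Measure.pi (fun _ => μ) ≤ mutualInfo μ η := by
    refine (lintegral_lintegral_codeword_le μ hkl).trans_eq ?_
    rw [lintegral_klDiv_eq_mutualInfo_add μ η _ hac, klDiv_self, add_zero]
  have he : ∫⁻ c, e c ∂Measure.pi (fun _ => μ) ≤ meanPackingError μ η T (Fintype.card V) :=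
    lintegral_lintegral_lintegral_le_of_countable _ _ _ (measurable_packingError_subcodebook η hT)
      fun w v => (lintegral_packingError_subcodebook μ η hT w v).le
  refine ⟨fun c => D c + l * e c + 1 - l, by fun_prop, fun c =>
    ENNReal.le_sub_of_add_le_right ENNReal.ofReal_ne_top (hle c), ?_⟩
  calc _ = ∫⁻ c, (D c + l * e c + 1 - l + l) ∂Measure.pi (fun _ => μ) := by
        rw [lintegral_add_right _ measurable_const, lintegral_const, measure_univ, mul_one]
    _ = ∫⁻ c, (D c + l * e c + 1) ∂Measure.pi (fun _ => μ) :=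
        lintegral_congr fun c => tsub_add_cancel_of_le (le_add_self.trans (hle c))
    _ = ∫⁻ c, D c ∂Measure.pi (fun _ => μ) + l * ∫⁻ c, e c ∂Measure.pi (fun _ => μ) + 1 := by
        rw [lintegral_add_right _ measurable_const, lintegral_add_left hDm,
          lintegral_const_mul _ hem, lintegral_one, measure_univ]
    _ ≤ _ := by gcongr

theorem exists_codebook [StandardBorelSpace α] [Nonempty α] (μ : Measure α)
    [IsProbabilityMeasure μ] (κ η : Kernel α β) [IsMarkovKernel κ] [IsMarkovKernel η]
    (hac : ∀ x, η x ≪ η ∘ₘ μ) {TB TE : Set (α × β)} (hTB : MeasurableSet TB)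
    (hTE : MeasurableSet TE) {p : α → Prop} (hp : ∀ᵐ x ∂μ, p x) {g : α → ℝ≥0∞} (hg : Measurable g)
    {l : ℝ≥0∞} (hl : mutualInfo μ η + ENNReal.ofReal (Real.log (Fintype.card V))
      * meanPackingError μ η TE (Fintype.card V) + 1
        ≤ l + ENNReal.ofReal (Real.log (Fintype.card V))) (r s t : ℝ≥0∞) :
    ∃ c : W × V → α, (∀ i, p (c i)) ∧
      r * ∫⁻ x, g x ∂(codebookEncoder c ∘ₘ uniformOn (Set.univ : Set W))
        + s * (uniformOn (Set.univ : Set W) ⊗ₘ (κ ∘ₖ codebookEncoder c))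
          {q | (typicalDecoder TB c q.2).1 ≠ q.1}
        + t * mutualInfo (uniformOn (Set.univ : Set W)) (η ∘ₖ codebookEncoder c)
      ≤ r * ∫⁻ x, g x ∂μ + s * meanPackingError μ κ TB (Fintype.card (W × V)) + t * l := by
  classical
  set P := Measure.pi fun _ : W × V => μ
  obtain ⟨X, hXm, hX, hXP⟩ :=
    exists_measurable_mutualInfo_codebookEncoder_le (W := W) (V := V) μ η hac hTE
  let G (c : W × V → α) := ∫⁻ w, ∫⁻ v, g (c (w, v))
    ∂uniformOn (Set.univ : Set V) ∂uniformOn (Set.univ : Set W)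
  let e (c : W × V → α) := ∫⁻ w, ∫⁻ v, packingError κ TB c (w, v)
    ∂uniformOn (Set.univ : Set V) ∂uniformOn (Set.univ : Set W)
  have hpm (w : W) (v : V) := measurable_packingError κ hTB (w, v)
  have hGm : Measurable G := measurable_lintegral_codeword hg
  have hem : Measurable e := measurable_lintegral_of_countable (fun w =>
    measurable_lintegral_of_countable (hpm w) _) _
  have hG : ∫⁻ c, G c ∂P ≤ ∫⁻ x, g x ∂μ := lintegral_lintegral_codeword_le μ hg
  have he : ∫⁻ c, e c ∂P ≤ meanPackingError μ κ TB (Fintype.card (W × V)) :=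
    lintegral_lintegral_lintegral_le_of_countable _ _ _ hpm fun w v =>
      (lintegral_packingError μ κ hTB (w, v)).le
  have hXl : ∫⁻ c, X c ∂P ≤ l :=
    (ENNReal.add_le_add_iff_right ENNReal.ofReal_ne_top).1 (hXP.trans hl)
  have hall : ∀ᵐ c ∂P, ∀ i, p (c i) := ae_all_iff.2 fun i =>
    (measurePreserving_eval (fun _ : W × V => μ) i).quasiMeasurePreserving.ae hp
  obtain ⟨c, hc, hcle⟩ := exists_notMem_null_le_lintegral
    (f := fun c => r * G c + s * e c + t * X c) (by fun_prop) hall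
  refine ⟨c, not_not.1 hc, (add_le_add (add_le_add ?_ ?_) ?_).trans (hcle.trans ?_)⟩
  · rw [lintegral_codebookEncoder_comp c hg]
  · exact mul_le_mul_right (compProd_codebookEncoder_ne_le c κ TB .of_discrete) s
  · exact mul_le_mul_right (hX c) t
  · rw [lintegral_add_right _ (hXm.const_mul t), lintegral_add_right _ (hem.const_mul s),
      lintegral_const_mul _ hGm, lintegral_const_mul _ hem, lintegral_const_mul _ hXm]
    gcongr

end OneShot

section BlockCoding

/-- The pairs of an input word and an output word that are jointly typical for the input law `μ`
and the channel `κ`: their information density exceeds `t`. -/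
def jointlyTypicalSet (μ : Measure ℝ) (κ : Kernel ℝ ℕ) (n : ℕ) (t : ℝ) :
    Set ((Fin n → ℝ) × (Fin n → ℕ)) :=
  {q | (fun i => (q.1 i, q.2 i)) ∈ typicalSet (μ ⊗ₘ κ) (μ.prod (κ ∘ₘ μ)) n t}

theorem measurableSet_jointlyTypicalSet (μ : Measure ℝ) (κ : Kernel ℝ ℕ) (n : ℕ) (t : ℝ) :
    MeasurableSet (jointlyTypicalSet μ κ n t) :=
  (MeasurableEquiv.arrowProdEquivProdArrow ℝ ℕ (Fin n)).symm.measurable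
    (measurableSet_typicalSet _ _ n t)

variable (μ : Measure ℝ) [IsProbabilityMeasure μ] (κ : Kernel ℝ ℕ) [IsMarkovKernel κ] (n : ℕ)

theorem memoryless_comp_pi :
    memoryless κ n ∘ₘ Measure.pi (fun _ => μ) = Measure.pi fun _ => κ ∘ₘ μ := by
  refine Measure.ext_of_singleton fun y => ?_
  rw [Measure.bind_apply (measurableSet_singleton y) (Kernel.aemeasurable _), Measure.pi_singleton]
  simp only [memoryless_apply, Measure.pi_singleton]
  rw [lintegral_prod_pi _ (f := fun i x => κ x {y i}) fun i =>
    κ.measurable_coe (measurableSet_singleton _)]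
  exact Finset.prod_congr rfl fun i _ =>
    (Measure.bind_apply (measurableSet_singleton _) (Kernel.aemeasurable _)).symm

theorem map_pi_compProd :
    (Measure.pi fun _ : Fin n => μ ⊗ₘ κ).map (MeasurableEquiv.arrowProdEquivProdArrow ℝ ℕ (Fin n))
      = Measure.pi (fun _ => μ) ⊗ₘ memoryless κ n := by
  set e := MeasurableEquiv.arrowProdEquivProdArrow ℝ ℕ (Fin n)
  rw [MeasurableEquiv.map_apply_eq_iff_map_symm_apply_eq]
  refine Measure.pi_eq fun s hs => ?_
  have hbox : MeasurableSet (e.symm ⁻¹' Set.univ.pi s) :=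
    e.symm.measurable (MeasurableSet.univ_pi hs)
  have hsection (x : Fin n → ℝ) : memoryless κ n x (Prod.mk x ⁻¹' (e.symm ⁻¹' Set.univ.pi s))
      = ∏ i, κ (x i) (Prod.mk (x i) ⁻¹' s i) := by
    rw [memoryless_apply, ← Measure.pi_pi]
    rfl
  rw [e.symm.map_apply, Measure.compProd_apply hbox, lintegral_congr hsection,
    lintegral_prod_pi _ (f := fun i x => κ x (Prod.mk x ⁻¹' s i)) fun i =>
      Kernel.measurable_kernel_prodMk_left (hs i)]
  exact Finset.prod_congr rfl fun i _ => (Measure.compProd_apply (hs i)).symm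

theorem map_pi_prod :
    (Measure.pi fun _ : Fin n => μ.prod (κ ∘ₘ μ)).map
        (MeasurableEquiv.arrowProdEquivProdArrow ℝ ℕ (Fin n))
      = (Measure.pi fun _ => μ).prod (memoryless κ n ∘ₘ Measure.pi (fun _ => μ)) := by
  rw [memoryless_comp_pi]
  exact (measurePreserving_arrowProdEquivProdArrow ℝ ℕ (Fin n) (fun _ => μ)
    fun _ => κ ∘ₘ μ).map_eq

theorem mutualInfo_memoryless :
    mutualInfo (Measure.pi fun _ => μ) (memoryless κ n) = n * mutualInfo μ κ := by
  rw [mutualInfo, ← map_pi_compProd, ← map_pi_prod, klDiv_map_measurableEquiv, klDiv_pi,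
    Finset.sum_const, Finset.card_univ, Fintype.card_fin, nsmul_eq_mul, mutualInfo]

theorem meanPackingError_jointlyTypicalSet_le (N : ℕ) (t : ℝ) :
    meanPackingError (Measure.pi fun _ => μ) (memoryless κ n) (jointlyTypicalSet μ κ n t) N
      ≤ Measure.pi (fun _ => μ ⊗ₘ κ) (typicalSet (μ ⊗ₘ κ) (μ.prod (κ ∘ₘ μ)) n t)ᶜ
        + (N - 1 : ℕ) * ENNReal.ofReal (Real.exp (-t)) := by
  rw [meanPackingError, ← map_pi_compProd, ← map_pi_prod, MeasurableEquiv.map_apply,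
    MeasurableEquiv.map_apply]
  exact add_le_add_right (mul_le_mul_right (pi_typicalSet_le _ _ n t) _) _

theorem tendsto_meanPackingError_zero (hfin : mutualInfo μ κ ≠ ∞) {r s C : ℝ}
    (hr : r < (mutualInfo μ κ).toReal) (hs : s < r) {N : ℕ → ℕ}
    (hN : ∀ n, ((N n - 1 : ℕ) : ℝ) ≤ C * Real.exp (n * s)) :
    Tendsto (fun n : ℕ => meanPackingError (Measure.pi fun _ => μ) (memoryless κ n)
      (jointlyTypicalSet μ κ n (n * r)) (N n)) atTop (𝓝 0) := by
  have hexp : Tendsto (fun n : ℕ => ENNReal.ofReal (C * Real.exp (-(r - s)) ^ n)) atTop (𝓝 0) := by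
    have hgeom := (tendsto_pow_atTop_nhds_zero_of_lt_one (Real.exp_pos (-(r - s))).le
      (Real.exp_lt_one_iff.2 (by linarith))).const_mul C
    simpa only [mul_zero, ENNReal.ofReal_zero] using ENNReal.tendsto_ofReal hgeom
  have hsum := (tendsto_pi_compl_typicalSet _ _ hfin hr).add hexp
  rw [add_zero] at hsum
  refine tendsto_of_tendsto_of_tendsto_of_le_of_le tendsto_const_nhds hsum (fun _ => zero_le)
    fun n => (meanPackingError_jointlyTypicalSet_le μ κ n _ _).trans (add_le_add_right ?_ _)
  rw [← ENNReal.ofReal_natCast, ← ENNReal.ofReal_mul (Nat.cast_nonneg _)]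
  refine ENNReal.ofReal_le_ofReal
    ((mul_le_mul_of_nonneg_right (hN n) (Real.exp_pos _).le).trans_eq ?_)
  rw [mul_assoc, ← Real.exp_add, ← Real.exp_nat_mul]
  ring_nf

end BlockCoding

section CodebookSize

theorem ceil_exp_sub_one_le (t : ℝ) : ((⌈Real.exp t⌉₊ - 1 : ℕ) : ℝ) ≤ Real.exp t := by
  rw [Nat.cast_pred (Nat.ceil_pos.2 (Real.exp_pos t)), sub_le_iff_le_add]
  exact (Nat.ceil_lt_add_one (Real.exp_pos t).le).le

theorem ceil_exp_le {t u : ℝ} (hu : 0 ≤ u) (htu : t ≤ u) :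
    (⌈Real.exp t⌉₊ : ℝ) ≤ 2 * Real.exp u := by
  have hceil := Nat.ceil_lt_add_one (Real.exp_pos t).le
  have hone := Real.one_le_exp hu
  have hmono := Real.exp_le_exp.2 htu
  linarith

theorem log_ceil_exp_le {t u : ℝ} (hu : 0 ≤ u) (htu : t ≤ u) :
    Real.log ⌈Real.exp t⌉₊ ≤ u + 1 := by
  have hpos : (0 : ℝ) < ⌈Real.exp t⌉₊ := Nat.cast_pos.2 (Nat.ceil_pos.2 (Real.exp_pos t))
  rw [Real.log_le_iff_le_exp hpos, Real.exp_add]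
  have htwo := Real.add_one_le_exp 1
  nlinarith [ceil_exp_le hu htu, Real.exp_pos u]

end CodebookSize

section Achievability

variable {A E : ℝ} {n M : ℕ}

section Code

variable {V : Type*} [MeasurableSpace V] [DiscreteMeasurableSpace V]

theorem ae_codebookEncoder {W α : Type*} [MeasurableSpace W] [DiscreteMeasurableSpace W]
    [Countable W] [MeasurableSpace α] {p : α → Prop} (hp : MeasurableSet {x | p x})
    {c : W × V → α} (hc : ∀ j, p (c j)) (w : W) :
    ∀ᵐ x ∂codebookEncoder c w, p x := by
  rw [codebookEncoder_apply, ae_map_iff Measurable.of_discrete.aemeasurable hp]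
  exact ae_of_all _ fun v => hc (w, v)

/-- The wiretap code that sends message `w` as the codeword `c (w, v)` for a uniformly random
`v`. -/
noncomputable def codebookCode [Finite V] [Nonempty V] [NeZero M] (c : Fin M × V → Fin n → ℝ)
    (hc : ∀ j i, c j i ∈ Set.Icc 0 A) (hE : 0 ≤ E)
    (havg : ∫⁻ x, ∑ i, ENNReal.ofReal (x i)
      ∂(codebookEncoder c ∘ₘ uniformOn (Set.univ : Set (Fin M))) ≤ ENNReal.ofReal (n * E))
    (dec : (Fin n → ℕ) → Fin M) : WiretapCode A E n M where
  enc := codebookEncoder c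
  markov := inferInstance
  dec := dec
  peak := ae_codebookEncoder (measurableSet_forall_apply_mem measurableSet_Icc) hc
  average := by
    have hset := measurableSet_forall_apply_mem (ι := Fin n) (measurableSet_Icc (a := 0) (b := A))
    rw [lintegral_sum_ofReal_eq (Measure.ae_comp_of_ae_ae hset
      (ae_of_all _ (ae_codebookEncoder hset hc)))] at havg
    refine div_le_of_le_mul₀ n.cast_nonneg hE ?_
    rw [mul_comm]
    exact (ENNReal.ofReal_le_ofReal_iff (by positivity)).1 havg

theorem nonempty_wiretapCode [NeZero M] (hA : 0 ≤ A) (hE : 0 ≤ E) :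
    Nonempty (WiretapCode A E n M) :=
  ⟨codebookCode (V := Unit) (fun _ _ => 0) (fun _ _ => ⟨le_rfl, hA⟩) hE
    (by rw [lintegral_codebookEncoder_comp _ (by fun_prop)]; simp) fun _ => 0⟩

end Code

variable {μ : Measure ℝ}

theorem nonneg_of_mem_feasible (hμ : μ ∈ feasible A E) : 0 ≤ E :=
  (integral_nonneg_of_ae (hμ.2.1.mono fun _ hx => hx.1)).trans hμ.2.2

theorem lintegral_sum_input_pi_le (hμ : μ ∈ feasible A E) (n : ℕ) :
    ∫⁻ x, ∑ i, ENNReal.ofReal (x i) ∂(Measure.pi fun _ : Fin n => μ)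
      ≤ n * ENNReal.ofReal E := by
  have := hμ.1
  have hcoord (i : Fin n) : ∫⁻ x, ENNReal.ofReal (x i) ∂(Measure.pi fun _ : Fin n => μ)
      ≤ ENNReal.ofReal E := by
    rw [(measurePreserving_eval (fun _ : Fin n => μ) i).lintegral_comp ENNReal.measurable_ofReal,
      lintegral_ofReal_eq_of_ae_mem_Icc (f := fun x => x) aestronglyMeasurable_id hμ.2.1]
    exact ENNReal.ofReal_le_ofReal hμ.2.2
  rw [lintegral_finsetSum _ fun i _ => by fun_prop]
  refine (Finset.sum_le_card_nsmul _ _ _ fun i _ => hcoord i).trans_eq ?_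
  rw [Finset.card_univ, Fintype.card_fin, nsmul_eq_mul]

variable {κB κE : Kernel ℝ ℕ} [IsMarkovKernel κB] [IsMarkovKernel κE] {E' : ℝ}

theorem memoryless_absolutelyContinuous_comp_pi [IsProbabilityMeasure μ]
    (hsupp : ∀ k, (κE ∘ₘ μ) {k} ≠ 0) (x : Fin n → ℝ) :
    memoryless κE n x ≪ memoryless κE n ∘ₘ Measure.pi fun _ => μ := by
  rw [memoryless_comp_pi]
  refine absolutelyContinuous_of_forall_singleton_ne_zero (fun y => ?_) _
  rw [Measure.pi_singleton]
  exact Finset.prod_ne_zero_iff.2 fun i _ => hsupp (y i)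

theorem exists_wiretapCode {K : ℕ} [NeZero M] [NeZero K] (hn : n ≠ 0) (hμ : μ ∈ feasible A E)
    (hE' : 0 < E') (hsupp : ∀ k, (κE ∘ₘ μ) {k} ≠ 0) {TB TE : Set ((Fin n → ℝ) × (Fin n → ℕ))}
    (hTB : MeasurableSet TB) (hTE : MeasurableSet TE) {l ε : ℝ≥0∞}
    (hl : n * mutualInfo μ κE + ENNReal.ofReal (Real.log K)
      * meanPackingError (Measure.pi fun _ => μ) (memoryless κE n) TE K + 1
        ≤ n * l + ENNReal.ofReal (Real.log K)) (hε0 : ε ≠ 0) (hε : ε ≠ ∞)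
    (hsum : ENNReal.ofReal E / ENNReal.ofReal E'
      + meanPackingError (Measure.pi fun _ => μ) (memoryless κB n) TB (M * K) / ε + l / ε ≤ 1) :
    ∃ C : WiretapCode A E' n M, C.errorProb κB ≤ ε ∧ C.leakage κE / n ≤ ε := by
  have := hμ.1
  have hn0 : (n : ℝ≥0∞) ≠ 0 := Nat.cast_ne_zero.2 hn
  have hn1 := ENNReal.natCast_ne_top n
  have hE0 : ENNReal.ofReal E' ≠ 0 := (ENNReal.ofReal_pos.2 hE').ne'
  have hpeak : ∀ᵐ x ∂(Measure.pi fun _ : Fin n => μ), ∀ i, x i ∈ Set.Icc 0 A :=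
    ae_all_iff.2 fun i =>
      (measurePreserving_eval (fun _ : Fin n => μ) i).quasiMeasurePreserving.ae hμ.2.1
  obtain ⟨c, hc, hle⟩ := exists_codebook (W := Fin M) (V := Fin K)
    (Measure.pi fun _ : Fin n => μ) (memoryless κB n) (memoryless κE n)
    (memoryless_absolutelyContinuous_comp_pi hsupp) hTB hTE hpeak
    (g := fun x => ∑ i, ENNReal.ofReal (x i)) (by fun_prop) (l := n * l)
    (by rwa [mutualInfo_memoryless, Fintype.card_fin])
    (n * ENNReal.ofReal E')⁻¹ ε⁻¹ (n * ε)⁻¹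
  rw [Fintype.card_prod, Fintype.card_fin, Fintype.card_fin] at hle
  have hle_one := hle.trans ((add_le_add_left (add_le_add_left
    (mul_le_mul_right (lintegral_sum_input_pi_le hμ n) _) _) _).trans_eq ?_ |>.trans hsum)
  · rw [add_assoc] at hle_one
    have havg := (le_self_add.trans hle_one)
    have herr := (le_self_add.trans (le_add_self.trans hle_one))
    have hleak := (le_add_self.trans (le_add_self.trans hle_one))
    rw [ENNReal.inv_mul_le_iff (mul_ne_zero hn0 hE0) (by finiteness), mul_one] at havg
    rw [ENNReal.inv_mul_le_iff hε0 hε, mul_one] at herr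
    rw [ENNReal.inv_mul_le_iff (mul_ne_zero hn0 hε0) (by finiteness), mul_one] at hleak
    refine ⟨codebookCode c hc hE'.le ?_ fun y => (typicalDecoder TB c y).1, herr,
      ENNReal.div_le_of_le_mul (by rwa [mul_comm])⟩
    rwa [ENNReal.ofReal_mul n.cast_nonneg, ENNReal.ofReal_natCast]
  · rw [mul_comm _⁻¹, ← div_eq_mul_inv, ENNReal.mul_div_mul_left _ _ hn0 hn1, mul_comm ε⁻¹,
      ← div_eq_mul_inv, mul_comm _⁻¹, ← div_eq_mul_inv, ENNReal.mul_div_mul_left _ _ hn0 hn1]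

theorem natCast_mul_ofReal_add_le (hn : n ≠ 0) {I δ : ℝ} (hI : 0 ≤ I) (hδ : 0 ≤ δ) (p : ℝ≥0∞) :
    n * ENNReal.ofReal I + ENNReal.ofReal (Real.log ⌈Real.exp (n * (I - δ))⌉₊) * p + 1
      ≤ n * (ENNReal.ofReal δ + ENNReal.ofReal (I + 1) * p + (n : ℝ≥0∞)⁻¹)
        + ENNReal.ofReal (Real.log ⌈Real.exp (n * (I - δ))⌉₊) := by
  set k := Real.log ⌈Real.exp (n * (I - δ))⌉₊
  have hone : (1 : ℝ) ≤ n := Nat.one_le_cast.2 (Nat.one_le_iff_ne_zero.2 hn)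
  have hlower : n * ENNReal.ofReal I ≤ n * ENNReal.ofReal δ + ENNReal.ofReal k := by
    rw [← ENNReal.ofReal_natCast, ← ENNReal.ofReal_mul n.cast_nonneg,
      ← ENNReal.ofReal_mul n.cast_nonneg]
    refine (ENNReal.ofReal_le_ofReal ?_).trans ENNReal.ofReal_add_le
    linarith [le_log_ceil_exp (n * (I - δ))]
  have hupper : ENNReal.ofReal k ≤ n * ENNReal.ofReal (I + 1) := by
    rw [← ENNReal.ofReal_natCast, ← ENNReal.ofReal_mul n.cast_nonneg]
    refine ENNReal.ofReal_le_ofReal ((log_ceil_exp_le (u := n * I) (by positivity) ?_).trans ?_)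
    · exact mul_le_mul_of_nonneg_left (by linarith) n.cast_nonneg
    · linarith
  calc _ ≤ (n * ENNReal.ofReal δ + ENNReal.ofReal k) + n * ENNReal.ofReal (I + 1) * p
        + n * (n : ℝ≥0∞)⁻¹ := by
        rw [ENNReal.mul_inv_cancel (Nat.cast_ne_zero.2 hn) (ENNReal.natCast_ne_top n)]
        gcongr
    _ = _ := by ring

theorem ceil_exp_mul_ceil_exp_sub_one_le {s t u : ℝ} (hs : 0 ≤ s) (hu : 0 ≤ u) (htu : t ≤ u) :
    ((⌈Real.exp s⌉₊ * ⌈Real.exp t⌉₊ - 1 : ℕ) : ℝ) ≤ 4 * Real.exp (s + u) := by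
  calc ((⌈Real.exp s⌉₊ * ⌈Real.exp t⌉₊ - 1 : ℕ) : ℝ)
      ≤ ⌈Real.exp s⌉₊ * ⌈Real.exp t⌉₊ := mod_cast Nat.sub_le _ _
    _ ≤ (2 * Real.exp s) * (2 * Real.exp u) := by
        gcongr
        · exact ceil_exp_le hs le_rfl
        · exact ceil_exp_le hu htu
    _ = 4 * Real.exp (s + u) := by rw [Real.exp_add]; ring

theorem ofReal_div_ofReal_lt_one (hE' : 0 < E') (hEE' : E < E') :
    ENNReal.ofReal E / ENNReal.ofReal E' < 1 := by
  rw [ENNReal.div_lt_iff (.inl (ENNReal.ofReal_pos.2 hE').ne') (.inl ENNReal.ofReal_ne_top),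
    one_mul]
  exact (ENNReal.ofReal_lt_ofReal_iff hE').2 hEE'

theorem exists_pos_add_ofReal_div_lt_one {a ε : ℝ≥0∞} (ha : a < 1) (hε : ε ≠ 0) :
    ∃ δ : ℝ, 0 < δ ∧ a + ENNReal.ofReal δ / ε < 1 := by
  have hcont : Continuous fun δ : ℝ => a + ENNReal.ofReal δ / ε :=
    continuous_const.add ((ENNReal.continuous_div_const ε hε).comp ENNReal.continuous_ofReal)
  have hlt := (hcont.tendsto 0).eventually_lt_const (u := 1) (by simpa using ha)
  obtain ⟨δ, hδ, hpos⟩ := ((hlt.filter_mono nhdsWithin_le_nhds).and self_mem_nhdsWithin).exists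
    (f := 𝓝[>] (0 : ℝ))
  exact ⟨δ, hpos, hδ⟩

theorem eventually_exists_wiretapCode {Δ R : ℝ} (hμ : μ ∈ feasible A E) (hEE' : E < E')
    (hsupp : ∀ k, (κE ∘ₘ μ) {k} ≠ 0) (hB : mutualInfo μ κB ≠ ∞) (hE : mutualInfo μ κE ≠ ∞)
    (hR : 0 ≤ Δ * R) (hlt : Δ * R + (mutualInfo μ κE).toReal < (mutualInfo μ κB).toReal)
    {ε : ℝ≥0∞} (hε0 : ε ≠ 0) (hε : ε ≠ ∞) :
    ∀ᶠ n : ℕ in atTop, ∃ C : WiretapCode A E' n ⌈Real.exp (n * Δ * R)⌉₊,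
      C.errorProb κB ≤ ε ∧ C.leakage κE / n ≤ ε := by
  have := hμ.1
  have hE' : 0 < E' := (nonneg_of_mem_feasible hμ).trans_lt hEE'
  obtain ⟨δ, hδ, hδε⟩ := exists_pos_add_ofReal_div_lt_one (ofReal_div_ofReal_lt_one hE' hEE') hε0
  obtain ⟨r, hr, hrB⟩ := exists_between hlt
  set I := (mutualInfo μ κE).toReal
  have hI : 0 ≤ I := ENNReal.toReal_nonneg
  have hpB := tendsto_meanPackingError_zero μ κB hB hrB hr
    (N := fun n => ⌈Real.exp (n * (Δ * R))⌉₊ * ⌈Real.exp (n * (I - δ))⌉₊) (C := 4) fun n =>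
      (ceil_exp_mul_ceil_exp_sub_one_le (u := n * I) (by positivity) (by positivity)
        (mul_le_mul_of_nonneg_left (by linarith) n.cast_nonneg)).trans_eq (by rw [mul_add])
  have hpE := tendsto_meanPackingError_zero μ κE hE (r := I - δ / 2) (s := I - δ) (by linarith)
    (by linarith) (N := fun n => ⌈Real.exp (n * (I - δ))⌉₊) (C := 1)
    fun n => by simpa only [one_mul] using ceil_exp_sub_one_le (n * (I - δ))
  have hleak := ((ENNReal.Tendsto.const_mul hpE (.inr (ENNReal.ofReal_ne_top (r := I + 1)))
    ).const_add (ENNReal.ofReal δ)).add ENNReal.tendsto_inv_nat_nhds_zero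
  have hsum := ((ENNReal.Tendsto.div_const hpB (.inr hε0)).const_add
    (ENNReal.ofReal E / ENNReal.ofReal E')).add (ENNReal.Tendsto.div_const hleak (.inr hε0))
  simp only [mul_zero, add_zero, ENNReal.zero_div] at hsum
  filter_upwards [hsum.eventually_le_const hδε, eventually_ne_atTop 0] with n hn hn0
  have : NeZero ⌈Real.exp (n * (Δ * R))⌉₊ := ⟨(Nat.ceil_pos.2 (Real.exp_pos _)).ne'⟩
  have : NeZero ⌈Real.exp (n * (I - δ))⌉₊ := ⟨(Nat.ceil_pos.2 (Real.exp_pos _)).ne'⟩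
  rw [mul_assoc]
  refine exists_wiretapCode hn0 hμ hE' hsupp (measurableSet_jointlyTypicalSet μ κB n _)
    (measurableSet_jointlyTypicalSet μ κE n (n * (I - δ / 2))) ?_ hε0 hε hn
  rw [← ENNReal.ofReal_toReal hE]
  exact natCast_mul_ofReal_add_le hn0 hI hδ.le _

theorem exists_tendsto_zero_of_eventually_exists_le {X : ℕ → Type*} [∀ n, Nonempty (X n)]
    {f : ∀ n, X n → ℝ≥0∞}
    (h : ∀ ε : ℝ≥0∞, ε ≠ 0 → ε ≠ ∞ → ∀ᶠ n in atTop, ∃ x, f n x ≤ ε) :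
    ∃ x : ∀ n, X n, Tendsto (fun n => f n (x n)) atTop (𝓝 0) := by
  have hchoice (n : ℕ) : ∃ x, f n x ≤ (⨅ x, f n x) + (n : ℝ≥0∞)⁻¹ := by
    rcases eq_or_ne (⨅ x, f n x) ∞ with htop | htop
    · exact ⟨Classical.arbitrary _, by simp [htop]⟩
    · obtain ⟨x, hx⟩ := iInf_lt_iff.1 (ENNReal.lt_add_right htop
        (ENNReal.inv_ne_zero.2 (ENNReal.natCast_ne_top n)))
      exact ⟨x, hx.le⟩
  choose x hx using hchoice
  have hinf : Tendsto (fun n => ⨅ x, f n x) atTop (𝓝 0) := by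
    refine ENNReal.tendsto_nhds_zero.2 fun ε hε => ?_
    filter_upwards [h (min ε 1) (lt_min hε one_pos).ne'
      (min_lt_of_right_lt ENNReal.one_lt_top).ne] with n hn
    obtain ⟨y, hy⟩ := hn
    exact (iInf_le _ y).trans (hy.trans (min_le_left _ _))
  have hsum := hinf.add ENNReal.tendsto_inv_nat_nhds_zero
  rw [add_zero] at hsum
  exact ⟨x, tendsto_of_tendsto_of_tendsto_of_le_of_le tendsto_const_nhds hsum (fun _ => zero_le) hx⟩

theorem mem_secureRates_of_lt {Δ R : ℝ} (hμ : μ ∈ feasible A E) (hEE' : E < E')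
    (hsupp : ∀ k, (κE ∘ₘ μ) {k} ≠ 0) (hB : mutualInfo μ κB ≠ ∞) (hE : mutualInfo μ κE ≠ ∞)
    (hΔ : 0 < Δ) (hR : 0 ≤ R) (hlt : R < infoDiff κB κE Δ μ) :
    R ∈ secureRates κB κE Δ A E' := by
  have := hμ.1
  obtain ⟨x, hx⟩ := hμ.2.1.exists
  have hE' : 0 ≤ E' := (nonneg_of_mem_feasible hμ).trans hEE'.le
  have hne (n : ℕ) : Nonempty (WiretapCode A E' n ⌈Real.exp (n * Δ * R)⌉₊) := by
    have : NeZero ⌈Real.exp (n * Δ * R)⌉₊ := ⟨(Nat.ceil_pos.2 (Real.exp_pos _)).ne'⟩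
    exact nonempty_wiretapCode (hx.1.trans hx.2) hE'
  rw [infoDiff, lt_div_iff₀' hΔ, lt_sub_iff_add_lt] at hlt
  obtain ⟨C, hC⟩ := exists_tendsto_zero_of_eventually_exists_le
    (f := fun (n : ℕ) (C : WiretapCode A E' n ⌈Real.exp (n * Δ * R)⌉₊) =>
      max (C.errorProb κB) (C.leakage κE / n)) fun ε hε0 hε =>
    (eventually_exists_wiretapCode hμ hEE' hsupp hB hE (mul_nonneg hΔ.le hR) hlt hε0 hε).mono
      fun n ⟨C, hC⟩ => ⟨C, max_le hC.1 hC.2⟩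
  exact ⟨hR, C,
    tendsto_of_tendsto_of_tendsto_of_le_of_le tendsto_const_nhds hC (fun _ => zero_le)
      fun _ => le_max_left _ _,
    tendsto_of_tendsto_of_tendsto_of_le_of_le tendsto_const_nhds hC (fun _ => zero_le)
      fun _ => le_max_right _ _⟩

end Achievability

section BinaryInput

variable {A E : ℝ}

theorem isProbabilityMeasure_binaryInput (hE : 0 ≤ E) (hEA : E ≤ A) :
    IsProbabilityMeasure (binaryInput A E) := by
  have hp : E / A ≤ 1 := div_le_one_of_le₀ hEA (hE.trans hEA)
  refine ⟨?_⟩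
  rw [binaryInput, Measure.add_apply, Measure.smul_apply, Measure.smul_apply, measure_univ,
    measure_univ, smul_eq_mul, smul_eq_mul, mul_one, mul_one,
    ← ENNReal.ofReal_add (sub_nonneg.2 hp) (div_nonneg hE (hE.trans hEA)), sub_add_cancel,
    ENNReal.ofReal_one]

theorem binaryInput_mem_feasible (hE : 0 < E) (hEA : E ≤ A) :
    binaryInput A E ∈ feasible A E := by
  have hA : 0 < A := hE.trans_le hEA
  refine ⟨isProbabilityMeasure_binaryInput hE.le hEA, ?_, ?_⟩
  · rw [binaryInput, ae_add_measure_iff]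
    exact ⟨Measure.ae_smul_measure ((ae_dirac_iff measurableSet_Icc).2 ⟨le_rfl, hA.le⟩) _,
      Measure.ae_smul_measure ((ae_dirac_iff measurableSet_Icc).2 ⟨hA.le, le_rfl⟩) _⟩
  · have hint (x : ℝ) (p : ℝ) :
        Integrable (fun y => y) (ENNReal.ofReal p • Measure.dirac x) :=
      (integrable_dirac (by finiteness)).smul_measure ENNReal.ofReal_ne_top
    rw [binaryInput, integral_add_measure (hint _ _) (hint _ _), integral_smul_measure,
      integral_smul_measure, integral_dirac, integral_dirac, smul_zero, zero_add,
      ENNReal.toReal_ofReal (div_pos hE hA).le, smul_eq_mul, div_mul_cancel₀ E hA.ne']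

theorem lintegral_binaryInput (f : ℝ → ℝ≥0∞) :
    ∫⁻ x, f x ∂binaryInput A E
      = ENNReal.ofReal (1 - E / A) * f 0 + ENNReal.ofReal (E / A) * f A := by
  rw [binaryInput, lintegral_add_measure, lintegral_smul_measure, lintegral_smul_measure,
    lintegral_dirac, lintegral_dirac, smul_eq_mul, smul_eq_mul]

variable {β : Type*} [MeasurableSpace β] (κ : Kernel ℝ β)

theorem comp_binaryInput :
    κ ∘ₘ binaryInput A E = ENNReal.ofReal (1 - E / A) • κ 0 + ENNReal.ofReal (E / A) • κ A := by
  rw [binaryInput, Measure.comp_add, Measure.comp_smul, Measure.comp_smul,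
    Measure.dirac_bind κ.measurable, Measure.dirac_bind κ.measurable]

theorem comp_binaryInput_ne_zero {κ : Kernel ℝ β} {s : Set β} (hs : κ 0 s ≠ 0) (hE : 0 < E)
    (hEA : E < A) : (κ ∘ₘ binaryInput A E) s ≠ 0 := by
  have hp : 0 < 1 - E / A := sub_pos.2 ((div_lt_one (hE.trans hEA)).2 hEA)
  rw [comp_binaryInput, Measure.add_apply, Measure.smul_apply, smul_eq_mul]
  exact (add_pos_of_pos_of_nonneg
    (ENNReal.mul_pos (ENNReal.ofReal_pos.2 hp).ne' hs) zero_le).ne'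

variable [IsMarkovKernel κ]

theorem mutualInfo_binaryInput_add [MeasurableSpace.CountablyGenerated β]
    (hac : ∀ x, κ x ≪ κ 0) (hE : 0 ≤ E) (hEA : E ≤ A) :
    mutualInfo (binaryInput A E) κ + klDiv (κ ∘ₘ binaryInput A E) (κ 0)
      = ENNReal.ofReal (E / A) * klDiv (κ A) (κ 0) := by
  have := isProbabilityMeasure_binaryInput hE hEA
  rw [← lintegral_klDiv_eq_mutualInfo_add _ κ _ hac, lintegral_binaryInput, klDiv_self, mul_zero,
    zero_add]

theorem klDiv_comp_binaryInput_le {u : β → ℝ} (hum : Measurable u) (hu0 : ∀ y, 0 ≤ u y)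
    (hu : κ A = (κ 0).withDensity fun y => ENNReal.ofReal (u y)) (hE : 0 ≤ E) (hEA : E ≤ A) :
    klDiv (κ ∘ₘ binaryInput A E) (κ 0)
      ≤ ENNReal.ofReal ((E / A) ^ 2) * ∫⁻ y, ENNReal.ofReal ((u y - 1) ^ 2) ∂κ 0 := by
  have hui : Integrable u (κ 0) := by
    rw [← lintegral_ofReal_ne_top_iff_integrable hum.aestronglyMeasurable (ae_of_all _ hu0),
      ← setLIntegral_univ, ← withDensity_apply _ .univ, ← hu]
    exact measure_ne_top _ _
  rw [comp_binaryInput, hu]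
  exact klDiv_mixture_le hum hu0 hui (div_nonneg hE (hE.trans hEA))
    (div_le_one_of_le₀ hEA (hE.trans hEA))

theorem tendsto_mutualInfo_binaryInput_div [MeasurableSpace.CountablyGenerated β]
    (hac : ∀ x, κ x ≪ κ 0) {u : β → ℝ} (hum : Measurable u) (hu0 : ∀ y, 0 ≤ u y)
    (hu : κ A = (κ 0).withDensity fun y => ENNReal.ofReal (u y))
    (hchi : ∫⁻ y, ENNReal.ofReal ((u y - 1) ^ 2) ∂κ 0 ≠ ∞) (hkl : klDiv (κ A) (κ 0) ≠ ∞)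
    (hA : 0 < A) :
    Tendsto (fun E => (mutualInfo (binaryInput A E) κ).toReal / E) (𝓝[>] 0)
      (𝓝 ((klDiv (κ A) (κ 0)).toReal / A)) := by
  set D := (klDiv (κ A) (κ 0)).toReal
  set χ := (∫⁻ y, ENNReal.ofReal ((u y - 1) ^ 2) ∂κ 0).toReal
  have hlower : Tendsto (fun E : ℝ => D / A - χ / A ^ 2 * E) (𝓝[>] 0) (𝓝 (D / A)) := by
    have hcont : Continuous fun E : ℝ => D / A - χ / A ^ 2 * E := by fun_prop
    simpa only [mul_zero, sub_zero] using (hcont.tendsto 0).mono_left nhdsWithin_le_nhds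
  have hsandwich : ∀ᶠ E in 𝓝[>] 0, D / A - χ / A ^ 2 * E
        ≤ (mutualInfo (binaryInput A E) κ).toReal / E
      ∧ (mutualInfo (binaryInput A E) κ).toReal / E ≤ D / A := by
    filter_upwards [Ioo_mem_nhdsGT hA] with E ⟨hE, hEA⟩
    have hadd := mutualInfo_binaryInput_add κ hac hE.le hEA.le
    have hfin := ENNReal.add_ne_top.1 (hadd ▸ ENNReal.mul_ne_top ENNReal.ofReal_ne_top hkl)
    have hloss := ENNReal.toReal_mono (ENNReal.mul_ne_top ENNReal.ofReal_ne_top hchi)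
      (klDiv_comp_binaryInput_le κ hum hu0 hu hE.le hEA.le)
    rw [ENNReal.toReal_mul, ENNReal.toReal_ofReal (by positivity)] at hloss
    replace hadd := congrArg ENNReal.toReal hadd
    rw [ENNReal.toReal_add hfin.1 hfin.2, ENNReal.toReal_mul,
      ENNReal.toReal_ofReal (by positivity)] at hadd
    have hloss0 := ENNReal.toReal_nonneg (a := klDiv (κ ∘ₘ binaryInput A E) (κ 0))
    rw [le_div_iff₀ hE, div_le_iff₀ hE]
    constructor
    · calc (D / A - χ / A ^ 2 * E) * E = E / A * D - (E / A) ^ 2 * χ := by ring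
        _ ≤ _ := by linarith
    · calc _ ≤ E / A * D := by linarith
        _ = D / A * E := by ring
  exact tendsto_of_tendsto_of_tendsto_of_le_of_le' hlower tendsto_const_nhds
    (hsandwich.mono fun _ h => h.1) (hsandwich.mono fun _ h => h.2)

end BinaryInput

section Asymptotics

variable {κB κE : Kernel ℝ ℕ} [IsMarkovKernel κB] [IsMarkovKernel κE] {Δ A L : ℝ}

theorem DegradedPair.mem_secureRates_of_lt_infoDiff_binaryInput {c R E E' : ℝ}
    (h : DegradedPair κB κE A c) (hΔ : 0 < Δ) (hE : 0 < E) (hEA : E < A) (hEE' : E < E')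
    (hR : 0 ≤ R) (hlt : R < infoDiff κB κE Δ (binaryInput A E)) :
    R ∈ secureRates κB κE Δ A E' := by
  have hμ := binaryInput_mem_feasible hE hEA.le
  exact mem_secureRates_of_lt hμ hEE'
    (fun k => comp_binaryInput_ne_zero (h.singleton_ne_zero_right k) hE hEA)
    (h.mutualInfo_left_ne_top hμ) (h.mutualInfo_right_ne_top hμ) hΔ hR hlt

theorem DegradedPair.infoDiff_binaryInput_le_secrecyCapacity {E E' : ℝ}
    (h : DegradedPair κB κE A (Δ * L)) (hΔ : 0 < Δ) (hL : 0 ≤ L) (hE : 0 < E) (hEA : E < A)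
    (hEE' : E < E') :
    infoDiff κB κE Δ (binaryInput A E) ≤ secrecyCapacity κB κE Δ A E' := by
  refine le_of_forall_lt fun R hR => ?_
  obtain ⟨R', hRR', hR'⟩ := exists_between hR
  refine hRR'.trans_le ?_
  rcases lt_or_ge R' 0 with hneg | hnonneg
  · exact hneg.le.trans (Real.sSup_nonneg fun _ h => h.1)
  · exact le_csSup ⟨L * E', fun _ => h.le_of_mem_secureRates hΔ hL (hE.trans hEE').le⟩
      (h.mem_secureRates_of_lt_infoDiff_binaryInput hΔ hE hEA hEE' hnonneg hR')

theorem DegradedPair.secureRates_nonempty {E : ℝ} (h : DegradedPair κB κE A (Δ * L)) (hΔ : 0 < Δ)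
    (hL : 0 < L) (hbin : Tendsto (fun E => infoDiff κB κE Δ (binaryInput A E) / E) (𝓝[>] 0) (𝓝 L))
    (hE : 0 < E) : (secureRates κB κE Δ A E).Nonempty := by
  obtain ⟨E₀, hpos, hE₀, hlt⟩ := ((hbin.eventually_const_lt hL).and
    (Ioo_mem_nhdsGT (lt_min hE h.pos))).exists
  exact ⟨0, h.mem_secureRates_of_lt_infoDiff_binaryInput hΔ hE₀ (hlt.trans_le (min_le_right _ _))
    (hlt.trans_le (min_le_left _ _)) le_rfl ((div_pos_iff_of_pos_right hE₀).1 hpos)⟩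

theorem DegradedPair.tendsto_singleLetter_div (h : DegradedPair κB κE A (Δ * L)) (hΔ : 0 < Δ)
    (hL : 0 ≤ L)
    (hbin : Tendsto (fun E => infoDiff κB κE Δ (binaryInput A E) / E) (𝓝[>] 0) (𝓝 L)) :
    Tendsto (fun E => singleLetter κB κE Δ A E / E) (𝓝[>] 0) (𝓝 L) := by
  refine tendsto_of_tendsto_of_tendsto_of_le_of_le' hbin tendsto_const_nhds ?_ ?_
  all_goals filter_upwards [Ioo_mem_nhdsGT h.pos] with E ⟨hE, hEA⟩
  all_goals
    have hle : L * E ∈ upperBounds (infoDiff κB κE Δ '' feasible A E) :=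
      Set.forall_mem_image.2 fun _ => h.infoDiff_le hΔ hL hE.le
  · gcongr
    exact le_csSup ⟨_, hle⟩ (Set.mem_image_of_mem _ (binaryInput_mem_feasible hE hEA.le))
  · exact (div_le_iff₀ hE).2 (Real.sSup_le hle (by positivity))

theorem DegradedPair.tendsto_secrecyCapacity_div (h : DegradedPair κB κE A (Δ * L)) (hΔ : 0 < Δ)
    (hL : 0 ≤ L)
    (hbin : Tendsto (fun E => infoDiff κB κE Δ (binaryInput A E) / E) (𝓝[>] 0) (𝓝 L)) :
    Tendsto (fun E => secrecyCapacity κB κE Δ A E / E) (𝓝[>] 0) (𝓝 L) := by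
  have hbacked : Tendsto (fun E : ℝ => E * (1 - E)) (𝓝[>] 0) (𝓝[>] 0) := by
    refine tendsto_nhdsWithin_of_tendsto_nhds_of_eventually_within _ ?_ ?_
    · have hcont : Continuous fun E : ℝ => E * (1 - E) := by fun_prop
      simpa only [zero_mul] using (hcont.tendsto 0).mono_left nhdsWithin_le_nhds
    · filter_upwards [Ioo_mem_nhdsGT one_pos] with E hE
      exact mul_pos hE.1 (sub_pos.2 hE.2)
  have hfactor : Tendsto (fun E : ℝ => 1 - E) (𝓝[>] 0) (𝓝 1) := by
    have hcont : Continuous fun E : ℝ => 1 - E := by fun_prop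
    simpa only [sub_zero] using (hcont.tendsto 0).mono_left nhdsWithin_le_nhds
  have hlower := (hbin.comp hbacked).mul hfactor
  rw [mul_one] at hlower
  refine tendsto_of_tendsto_of_tendsto_of_le_of_le' hlower tendsto_const_nhds ?_ ?_
  · filter_upwards [Ioo_mem_nhdsGT (lt_min h.pos one_pos)] with E ⟨hE, hlt⟩
    have hE1 : 0 < 1 - E := sub_pos.2 (hlt.trans_le (min_le_right _ _))
    have hback : E * (1 - E) < E := by nlinarith
    rw [Function.comp_apply, div_mul_eq_mul_div, mul_div_mul_right _ _ hE1.ne']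
    gcongr
    exact h.infoDiff_binaryInput_le_secrecyCapacity hΔ hL (mul_pos hE hE1)
      (hback.trans (hlt.trans_le (min_le_left _ _))) hback
  · filter_upwards [self_mem_nhdsWithin] with E hE
    exact (div_le_iff₀ hE).2 (Real.sSup_le (fun _ => h.le_of_mem_secureRates hΔ hL (le_of_lt hE))
      (mul_nonneg hL (le_of_lt hE)))

end Asymptotics

section PoissonPair

variable {A Δ : ℝ}

theorem tendsto_mutualInfo_binaryInput_poissonChannel_div {a l : ℝ} (ha : 0 ≤ a) (hl : 0 < l)
    (hΔ : 0 < Δ) (hA : 0 < A) :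
    Tendsto (fun E => (mutualInfo (binaryInput A E) (poissonChannel a l Δ)).toReal / E) (𝓝[>] 0)
      (𝓝 (Δ * divRate a l A / A)) := by
  have hkl := klDiv_poissonChannel ha hl hΔ hA.le
  have hlim := tendsto_mutualInfo_binaryInput_div (poissonChannel a l Δ)
    (fun x => absolutelyContinuous_of_forall_singleton_ne_zero
      (poissonChannel_zero_singleton_ne_zero a hl hΔ) _)
    .of_discrete (fun _ => by positivity)
    (poissonMeasure_eq_withDensity _ (Real.toNNReal_pos.2 (by positivity)))
    (lintegral_poisson_chiSq_ne_top _ _) (hkl ▸ ENNReal.ofReal_ne_top) hA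
  rwa [hkl, ENNReal.toReal_ofReal (mul_nonneg hΔ.le (divRate_nonneg ha hl hA.le))] at hlim

variable {aB lB aE lE : ℝ}

theorem tendsto_infoDiff_binaryInput_div (haB : 0 ≤ aB) (haE : 0 ≤ aE) (hlB : 0 < lB)
    (hlE : 0 < lE) (hΔ : 0 < Δ) (hA : 0 < A) :
    Tendsto (fun E => infoDiff (poissonChannel aB lB Δ) (poissonChannel aE lE Δ) Δ
      (binaryInput A E) / E) (𝓝[>] 0) (𝓝 ((divRate aB lB A - divRate aE lE A) / A)) := by
  have hlim := ((tendsto_mutualInfo_binaryInput_poissonChannel_div haB hlB hΔ hA).sub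
    (tendsto_mutualInfo_binaryInput_poissonChannel_div haE hlE hΔ hA)).div_const Δ
  have hval : (Δ * divRate aB lB A / A - Δ * divRate aE lE A / A) / Δ =
      (divRate aB lB A - divRate aE lE A) / A := by
    field_simp
  rw [hval] at hlim
  exact hlim.congr fun E => by rw [infoDiff, ← sub_div, div_right_comm]

theorem exists_forall_klDiv_poissonChannel_le {a l : ℝ} (ha : 0 ≤ a) (hl : 0 < l) (hΔ : 0 < Δ)
    (A : ℝ) : ∃ D : ℝ≥0, ∀ x ∈ Set.Icc 0 A,
      klDiv (poissonChannel a l Δ x) (poissonChannel a l Δ 0) ≤ D := by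
  have hcont : ContinuousOn (fun x => Δ * divRate a l x) (Set.Icc 0 A) := fun x hx =>
    ((hasDerivAt_divRate ha hl hx.1).continuousAt.const_mul Δ).continuousWithinAt
  obtain ⟨D, hD⟩ := isCompact_Icc.bddAbove_image hcont
  refine ⟨D.toNNReal, fun x hx => ?_⟩
  rw [klDiv_poissonChannel ha hl hΔ hx.1]
  exact ENNReal.ofReal_le_ofReal (hD (Set.mem_image_of_mem _ hx))

theorem degradedPair_poissonChannel (haE : 0 < aE) (hlB : 0 < lB) (hlE : 0 < lE) (hΔ : 0 < Δ)
    (hA : 0 < A) (hgain : aE ≤ aB) (hdark : lB / aB ≤ lE / aE) :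
    DegradedPair (poissonChannel aB lB Δ) (poissonChannel aE lE Δ) A
      (Δ * ((divRate aB lB A - divRate aE lE A) / A)) where
  pos := hA
  exists_kernel := by
    obtain ⟨T, hT, hTx⟩ := exists_degrading_kernel haE hlB.le hlE.le hΔ.le hgain hdark
    exact ⟨T, hT, fun x hx => hTx x hx.1⟩
  singleton_ne_zero_left := poissonChannel_zero_singleton_ne_zero aB hlB hΔ
  singleton_ne_zero_right := poissonChannel_zero_singleton_ne_zero aE hlE hΔ
  bounded := exists_forall_klDiv_poissonChannel_le haE.le hlE hΔ A
  gap x hx := by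
    have hslope := mul_le_mul_of_nonneg_left
      (divRate_sub_le haE hlB hlE hgain hdark hx.1 hx.2 hA) hΔ.le
    rw [klDiv_poissonChannel (haE.le.trans hgain) hlB hΔ hx.1,
      klDiv_poissonChannel haE.le hlE hΔ hx.1, ← ENNReal.ofReal_mul' hx.1]
    refine (ENNReal.ofReal_le_ofReal ?_).trans ENNReal.ofReal_add_le
    linarith

end PoissonPair

end PoissonWiretap

/-- The degraded discrete-time Poisson wiretap channel with gains `aB`, `aE`, dark currents `lB`,
`lE` and pulse duration `Δ`, for a fixed peak intensity `A` and average intensity `E → 0`. -/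
theorem theorem6 (aB lB aE lE Δ A : ℝ) (haE : 0 < aE) (hlB : 0 < lB) (hlE : 0 < lE)
    (hΔ : 0 < Δ) (hA : 0 < A) (hgain : aE ≤ aB) (hdark : lB / aB ≤ lE / aE)
    (hstrict : aE < aB ∨ lB / aB < lE / aE) :
    let κB := PoissonWiretap.poissonChannel aB lB Δ
    let κE := PoissonWiretap.poissonChannel aE lE Δ
    let L : ℝ := (aB + lB / A) * Real.log (1 + aB * A / lB)
      - (aE + lE / A) * Real.log (1 + aE * A / lE) + (aE - aB)
    -- the suprema below are over nonempty bounded sets, and all informations are finite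
    (∀ E, 0 < E →
      (PoissonWiretap.secureRates κB κE Δ A E).Nonempty ∧
      BddAbove (PoissonWiretap.secureRates κB κE Δ A E) ∧
      BddAbove (PoissonWiretap.infoDiff κB κE Δ '' PoissonWiretap.feasible A E) ∧
      ∀ μ ∈ PoissonWiretap.feasible A E,
        PoissonWiretap.mutualInfo μ κB ≠ ∞ ∧ PoissonWiretap.mutualInfo μ κE ≠ ∞) ∧
    -- the limit, for the operational secrecy capacity and for its single-letter expression
    Tendsto (fun E => PoissonWiretap.secrecyCapacity κB κE Δ A E / E) (𝓝[>] 0) (𝓝 L) ∧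
    Tendsto (fun E => PoissonWiretap.singleLetter κB κE Δ A E / E) (𝓝[>] 0) (𝓝 L) ∧
    0 < L ∧
    -- the binary input is feasible and achieves the secrecy capacity asymptotically
    (∀ E, 0 < E → E ≤ A →
      PoissonWiretap.binaryInput A E ∈ PoissonWiretap.feasible A E) ∧
    Tendsto (fun E => PoissonWiretap.infoDiff κB κE Δ (PoissonWiretap.binaryInput A E) / E)
      (𝓝[>] 0) (𝓝 L) ∧
    Tendsto (fun E => PoissonWiretap.infoDiff κB κE Δ (PoissonWiretap.binaryInput A E) /
      PoissonWiretap.secrecyCapacity κB κE Δ A E) (𝓝[>] 0) (𝓝 1) := by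
  intro κB κE L
  have haB : 0 < aB := haE.trans_le hgain
  have hgap : (PoissonWiretap.divRate aB lB A - PoissonWiretap.divRate aE lE A) / A = L :=
    PoissonWiretap.divRate_sub_div hA.ne'
  have hL : 0 < L :=
    hgap ▸ div_pos (PoissonWiretap.divRate_sub_pos haE hlB hlE hgain hdark hstrict hA) hA
  have hpair : PoissonWiretap.DegradedPair κB κE A (Δ * L) :=
    hgap ▸ PoissonWiretap.degradedPair_poissonChannel haE hlB hlE hΔ hA hgain hdark
  have hbin : Tendsto (fun E => PoissonWiretap.infoDiff κB κE Δ
      (PoissonWiretap.binaryInput A E) / E) (𝓝[>] 0) (𝓝 L) :=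
    hgap ▸ PoissonWiretap.tendsto_infoDiff_binaryInput_div haB.le haE.le hlB hlE hΔ hA
  have hcap := hpair.tendsto_secrecyCapacity_div hΔ hL.le hbin
  refine ⟨fun E hE => ⟨hpair.secureRates_nonempty hΔ hL hbin hE,
      ⟨L * E, fun _ => hpair.le_of_mem_secureRates hΔ hL.le hE.le⟩,
      ⟨L * E, Set.forall_mem_image.2 fun _ => hpair.infoDiff_le hΔ hL.le hE.le⟩,
      fun _ hμ => ⟨hpair.mutualInfo_left_ne_top hμ, hpair.mutualInfo_right_ne_top hμ⟩⟩,
    hcap, hpair.tendsto_singleLetter_div hΔ hL.le hbin, hL,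
    fun _ => PoissonWiretap.binaryInput_mem_feasible, hbin, ?_⟩
  have hratio := hbin.div hcap hL.ne'
  rw [div_self hL.ne'] at hratio
  refine hratio.congr' ?_
  filter_upwards [self_mem_nhdsWithin] with E hE
  exact div_div_div_cancel_right₀ (ne_of_gt hE) _ _
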